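/- **Setting.** Let $y_t=x_t+\sigma\zeta_t$, $t\in\mathbb Z$, where $x:\mathbb Z\to\mathbb C$ is deterministic, $\sigma>0$, and the $\zeta_t$ are i.i.d. standard complex Gaussian (real and imaginary parts are independent $\mathcal N(0,1)$). Let $[u*v]_t=\sum_{\tau}u_\tau v_{t-\tau}$, $[\Delta^k u]_t=u_{t-k}$ for $k\in\mathbb Z$, and $\|u\|_{n,2}=(\sum_{t=0}^n|u_t|^2)^{1/2}$. Let $\|u\|^*_{n,1}=\sum_{k=0}^n|[F_nu]_k|$, where $[F_nu]_k=(n+1)^{-1/2}\sum_{t=0}^n u_te^{2\pi i kt/(n+1)}$. Let $\mathbb C(\mathbb Z_{a,b})$ be the set of sequences vanishing outside $[a,b]$. *Predictability.* $x$ is $(m,n,h,\varrho)$-predictable if there is $\varphi\in\mathbb C(\mathbb Z_{h,m+h})$ with $\mathbf E|x_t-[\varphi*y]_t|^2\le\varrho\sigma^2/(m+1)$ for all $-m+h\le t\le n+h$. *Assumption 1 on $[-n,n+h]$, with parameters $s,\varkappa$.* $1\le s\le n+1$, $\varkappa\ge0$, and $x=x^{\mathcal S}+\varepsilon$, where $x^{\mathcal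 S}\in\mathcal S$ for some linear subspace $\mathcal S$ of $\mathbb C^{\mathbb Z}$ of dimension $s$ with $\Delta\mathcal S\subseteq\mathcal S$, and $\|\Delta^\tau\varepsilon\|_{n,2}\le\varkappa\sigma$ for all integers $-h\le\tau\le n$ (i.e. on all windows of $n+1$ consecutive points of $[-n,n+h]$). *$h$-predicting constrained least-squares estimator with parameter $\overline\varrho$.* $\widehat\varphi*y$, where $\widehat\varphi$ is any minimizer of $\|\Delta^{-h}[y-\varphi*y]\|_{n,2}^2$ over $\varphi\in\mathbb C(\mathbb Z_{h,n+h})$ subject to $\|\Delta^{-h}\varphi\|^*_{n,1}\le\overline\varrho/\sqrt{n+1}$. **Proposition.** There is an absolute constant $C>0$ such that the following holds. Let $m\ge1$, $n=2m$, $h_0\ge0$ be integers and let $\varrho\ge1$. Suppose that $x$ is $(m,n+2h_0,h_0,\varrho)$-predictable and that Assumption 1 holds on $[-n,n+2h_0]$ with parameters $s,\varkappa$. Then for every $\alpha\in(0,1)$ there is a (measurable) set $\Xi_\alpha$ of noise realizations with $\mathbb P\{\zeta\in\Xi_\alpha\}\ge1-\alpha$ such that, whenever $\zeta\in\Xi_\alpha$,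 every $2h_0$-predicting constrained least-squares filter $\widehat\varphi$ with $\overline\varrho=2\varrho$ satisfies $$\big\|\Delta^{-2h_0}[x-\widehat\varphi*y]\big\|_{n,2}^2\le C\sigma^2\big[\varrho^2(1+\ln(1/\alpha))+E_0\big],$$ $$\big|[x-\widehat\varphi*y]_t\big|^2\le C\,\frac{\sigma^2\varrho}{n+1}\big[\varrho^2(1+\ln(1/\alpha))+E_0\big]\quad\text{for all integers } t\in[m+3h_0,\,n+3h_0],$$ where $$E_0=\varrho\,\frac{n+1}{m+1}\,\ln\frac{m+n}{\alpha}+\varrho\,\varkappa\sqrt{1+\ln(1/\alpha)}+s .$$ (The filter $\widehat\varphi$ and the values $[\widehat\varphi*y]_t$ above involve only the observations on $[-n,n+2h_0]$, so the pointwise bound extends the recovery up to $t=n+3h_0$, beyond the observation domain when $h_0\ge1$.) -/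

import Mathlib

open MeasureTheory ProbabilityTheory

noncomputable section

/-- The space of two-sided sequences vanishing outside the integer interval `[a, b]`. -/
def seqSupportedOn (a b : ℤ) : Set (ℤ → ℂ) :=
  {u | ∀ t : ℤ, t ∉ Set.Icc a b → u t = 0}

/-- The power `k` (possibly negative) of the right shift: `(shiftSeq k u) t = u (t - k)`. -/
def shiftSeq (k : ℤ) (u : ℤ → ℂ) : ℤ → ℂ :=
  fun t => u (t - k)

/-- Convolution of two-sided sequences. It is only applied to finitely supported `u`,
for which the series is a finite sum. -/
def convSeq (u v : ℤ → ℂ) : ℤ → ℂ :=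
  fun t => ∑' τ : ℤ, u τ * v (t - τ)

/-- The Euclidean norm of the vector `(u 0, …, u n)`. -/
def windowNorm (n : ℕ) (u : ℤ → ℂ) : ℝ :=
  √(∑ t ∈ Finset.range (n + 1), ‖u (t : ℤ)‖ ^ 2)

/-- The coefficient number `k` of the unitary discrete Fourier transform of `(u 0, …, u n)`. -/
def dftCoeff (n : ℕ) (u : ℤ → ℂ) (k : ℕ) : ℂ :=
  ((√((n : ℝ) + 1))⁻¹ : ℝ) *
    ∑ t ∈ Finset.range (n + 1),
      u (t : ℤ) * Complex.exp (2 * Real.pi * Complex.I * k * t / (n + 1))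

/-- The `ℓ₁` norm of the unitary discrete Fourier transform of `(u 0, …, u n)`. -/
def dftNormOne (n : ℕ) (u : ℤ → ℂ) : ℝ :=
  ∑ k ∈ Finset.range (n + 1), ‖dftCoeff n u k‖

/-- The observed sequence `y = x + σ z` when the noise takes the value `z`. -/
def observedSeq (x : ℤ → ℂ) (σ : ℝ) (z : ℤ → ℂ) : ℤ → ℂ :=
  fun t => x t + σ * z t

/-- `ζ` is a family of i.i.d. standard complex Gaussian random variables, normalised so that
the real and the imaginary part of each `ζ t` are independent standard real Gaussians. -/
structure IsStdComplexGaussianNoise {Ω : Type*} [MeasurableSpace Ω] (μ : Measure Ω)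
    (ζ : ℤ → Ω → ℂ) : Prop where
  measurable : ∀ t, Measurable (ζ t)
  law_re : ∀ t, μ.map (fun ω => (ζ t ω).re) = gaussianReal 0 1
  law_im : ∀ t, μ.map (fun ω => (ζ t ω).im) = gaussianReal 0 1
  indep : iIndepFun
    (fun (p : ℤ × Bool) (ω : Ω) => if p.2 then (ζ p.1 ω).re else (ζ p.1 ω).im) μ

/-- `x` is `(m, n, h, ρ)`-predictable from its noisy observations `x + σ ζ`: some filter supported
on `[h, m + h]` reproduces `x` on `[-m + h, n + h]` with mean square error
at most `ρ σ² / (m + 1)`. -/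
def IsPredictableSignal {Ω : Type*} [MeasurableSpace Ω] (μ : Measure Ω) (ζ : ℤ → Ω → ℂ) (σ : ℝ)
    (m n h : ℕ) (ρ : ℝ) (x : ℤ → ℂ) : Prop :=
  ∃ φ ∈ seqSupportedOn (h : ℤ) ((m : ℤ) + h),
    ∀ t : ℤ, -(m : ℤ) + h ≤ t → t ≤ (n : ℤ) + h →
      ∫ ω, ‖x t - convSeq φ (observedSeq x σ (fun τ => ζ τ ω)) t‖ ^ 2 ∂μ
        ≤ ρ * σ ^ 2 / ((m : ℝ) + 1)

/-- Approximate shift-invariance of `x` on the interval `[a, b]`: `x = xS + ε`, where `xS` belongs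
to a shift-invariant subspace of dimension `s`, with `1 ≤ s ≤ n + 1`, and where `ε` has Euclidean
norm at most `ϰ σ` on every window `[-τ, n - τ]` of `n + 1` consecutive points of `[a, b]`. -/
def IsNearShiftInvariantOn (a b : ℤ) (n s : ℕ) (ϰ σ : ℝ) (x : ℤ → ℂ) : Prop :=
  1 ≤ s ∧ s ≤ n + 1 ∧
    ∃ S : Submodule ℂ (ℤ → ℂ),
      FiniteDimensional ℂ S ∧ Module.finrank ℂ S = s ∧
      (∀ u ∈ S, shiftSeq 1 u ∈ S) ∧
      ∃ xS ∈ S, ∃ ε : ℤ → ℂ, x = xS + ε ∧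
        ∀ τ : ℤ, a ≤ -τ → (n : ℤ) - τ ≤ b → windowNorm n (shiftSeq τ ε) ≤ ϰ * σ

/-- The feasible filters of the `h`-predicting constrained least-squares problem. -/
def predictFeasible (n h : ℕ) (r : ℝ) : Set (ℤ → ℂ) :=
  {φ | φ ∈ seqSupportedOn (h : ℤ) ((n : ℤ) + h) ∧
    dftNormOne n (shiftSeq (-(h : ℤ)) φ) ≤ r / √((n : ℝ) + 1)}

/-- `φ` is an optimal solution of the `h`-predicting constrained least-squares problem
with data `y` and constraint level `r`. -/
def IsPredictLSE (n h : ℕ) (r : ℝ) (y φ : ℤ → ℂ) : Prop :=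
  φ ∈ predictFeasible n h r ∧
    IsMinOn (fun ψ => windowNorm n (shiftSeq (-(h : ℤ)) (y - convSeq ψ y)) ^ 2)
      (predictFeasible n h r) φ

/-- The remainder term
`ρ κ² ln((m + n) / α) + ρ ϰ √(1 + ln(1 / α)) + s`, with `κ² = (n + 1) / (m + 1)`. -/
def oracleRemainder (m n : ℕ) (ρ ϰ : ℝ) (s : ℕ) (α : ℝ) : ℝ :=
  ρ * (((n : ℝ) + 1) / ((m : ℝ) + 1)) * Real.log (((m : ℝ) + n) / α)
    + ρ * ϰ * √(1 + Real.log (1 / α)) + s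

end

/-! ### Exponential moments of Gaussian quadratic forms -/

/-! If `q` is the predicting filter, the self-convolution `q * q` is an oracle that competes with
the least-squares filter. The mean square error of `q` is squared bias plus `2 σ² ‖q‖₂²`, so
predictability gives `‖q‖₂² ≤ ρ / (2 (m + 1))`. Since `n = 2 m` there is no wrap-around: the
transform of `q * q` is a rescaled square of that of `q`, and Parseval gives it ℓ₁ norm at most `ρ /
√(n + 1)` (`dftNormOne_oracle_le`). The oracle is thus feasible, with squared window error of order
`σ² ρ² (1 + ln (1/α))`.

Comparing the two residuals leaves the cross term `⟪w, δ * y⟫`, where `w` is the noise window and `δ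
= φ - q * q` (`norm_sq_le_of_norm_add_le`). Let `K` be the space of windows of the shift-invariant
subspace, of dimension at most `s`. The component of `w` in `K` has squared norm of order `s + ln
(1/α)`, up to constants. The component in `Kᗮ` does not see `δ * xS`. Against `δ * ε` and `δ * z`,
one expands `δ` in harmonic filters with coefficients of ℓ₁ norm at most `4 ρ / √(n + 1)`. Only `n +
1` fixed quantities then need control, although `φ` depends on the data
(`norm_inner_window_convSeq_le`). Those with `z` are quadratic in the noise and are handled by
Chernoff bounds for Gaussian quadratic forms (`isNoiseEvent_inner_convSeq`).

The pointwise bound comes from applying `1 - q` to the error `e = x - φ * y`. With `g = x - q * x`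
this gives `e = q * e + g - φ * g - σ φ * z + σ φ * (q * z)`. Cauchy–Schwarz turns the window bound
into a bound on `q * e`, and the other terms are small directly (`norm_sq_error_apply_le`). -/

theorem exp_neg_add_sq_le_one_sub {u : ℝ} (hu : |u| ≤ 1 / 2) :
    Real.exp (-(u + u ^ 2)) ≤ 1 - u := by
  obtain ⟨h1, h2⟩ := abs_le.1 hu
  rw [Real.exp_neg, inv_le_comm₀ (Real.exp_pos _) (by linarith), inv_le_iff_one_le_mul₀ (by linarith)]
  rcases le_total 0 u with h | h
  · have := Real.quadratic_le_exp_of_nonneg (x := u + u ^ 2) (by positivity)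
    refine le_trans ?_ (mul_le_mul_of_nonneg_right this (by linarith))
    have : 0 ≤ u ^ 2 * ((1 / 2 - u) * (1 + u + u ^ 2)) := by
      have : 0 ≤ 1 / 2 - u := by linarith
      positivity
    nlinarith [mul_nonneg (pow_nonneg h 3) (by linarith : (0:ℝ) ≤ 1 / 2 - u), pow_nonneg h 2]
  · have := Real.add_one_le_exp (u + u ^ 2)
    refine le_trans ?_ (mul_le_mul_of_nonneg_right this (by linarith))
    nlinarith [mul_nonneg (neg_nonneg.2 h) (sq_nonneg u)]

theorem integral_exp_mul_sq_gaussianReal {c : ℝ} (hc : c < 1 / 2) :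
    ∫ x, Real.exp (c * x ^ 2) ∂(gaussianReal 0 1) = √(1 / (1 - 2 * c)) := by
  rw [integral_gaussianReal_eq_integral_smul one_ne_zero]
  have : ∀ x : ℝ, gaussianPDFReal 0 1 x • Real.exp (c * x ^ 2)
      = (√(2 * Real.pi))⁻¹ * Real.exp (-(1 / 2 - c) * x ^ 2) := by
    intro x
    simp only [gaussianPDFReal, smul_eq_mul, mul_assoc, ← Real.exp_add]
    simp only [NNReal.coe_one, mul_one, sub_zero]
    congr 2
    ring
  simp_rw [this]
  rw [integral_const_mul, integral_gaussian, ← Real.sqrt_inv, ← Real.sqrt_mul (by positivity)]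
  congr 1
  have : (1 / 2 - c) ≠ 0 := by linarith
  have h' : 1 - 2 * c ≠ 0 := by linarith
  field_simp

/-- A non-integrable function has Bochner integral `0`, whereas the closed form above is positive.
-/
theorem integrable_exp_mul_sq_gaussianReal {c : ℝ} (hc : c < 1 / 2) :
    Integrable (fun x => Real.exp (c * x ^ 2)) (gaussianReal 0 1) := by
  by_contra h
  have h1 := integral_exp_mul_sq_gaussianReal hc
  rw [integral_undef h] at h1
  have : 0 < 1 / (1 - 2 * c) := by
    apply one_div_pos.2; linarith
  exact (Real.sqrt_pos.2 this).ne h1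

theorem integral_exp_mul_sq_gaussianReal_le {c : ℝ} (hc : |c| ≤ 1 / 4) :
    ∫ x, Real.exp (c * x ^ 2) ∂(gaussianReal 0 1) ≤ Real.exp (c + 2 * c ^ 2) := by
  have hc' := (abs_le.1 hc).2
  rw [integral_exp_mul_sq_gaussianReal (by linarith)]
  refine Real.sqrt_le_iff.2 ⟨(Real.exp_pos _).le, ?_⟩
  have h := exp_neg_add_sq_le_one_sub (u := 2 * c)
    (by rw [abs_mul, abs_of_pos (two_pos)]; linarith)
  rw [one_div, inv_le_comm₀ (by linarith) (by positivity), ← Real.exp_nat_mul, ← Real.exp_neg]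
  refine le_trans (le_of_eq ?_) h
  congr 1
  push_cast
  ring

/-- Both sides are the squared Hilbert–Schmidt norm, summed over the rows or over the columns of the
matrix of `T`. The choice of bases is therefore immaterial. -/
theorem OrthonormalBasis.sum_norm_sq_adjoint {E ι κ : Type*} [NormedAddCommGroup E]
    [InnerProductSpace ℝ E] [FiniteDimensional ℝ E] [Fintype ι] [Fintype κ]
    (b : OrthonormalBasis ι ℝ E) {F : Type*} [NormedAddCommGroup F] [InnerProductSpace ℝ F]
    [FiniteDimensional ℝ F] (c : OrthonormalBasis κ ℝ F) (T : E →ₗ[ℝ] F) :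
    ∑ j, ‖LinearMap.adjoint T (c j)‖ ^ 2 = ∑ i, ‖T (b i)‖ ^ 2 := by
  simp_rw [← b.sum_sq_inner_right (LinearMap.adjoint T _), ← c.sum_sq_inner_right (T _)]
  rw [Finset.sum_comm]
  refine Finset.sum_congr rfl fun i _ => Finset.sum_congr rfl fun j _ => ?_
  rw [LinearMap.adjoint_inner_right, real_inner_comm]

section QuadraticForm

variable {E : Type*} [NormedAddCommGroup E] [InnerProductSpace ℝ E] [FiniteDimensional ℝ E]
  [MeasurableSpace E] [BorelSpace E]

/-- In an eigenbasis of `S` the Gaussian coordinates stay independent, so the integral factors into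
one-dimensional ones. The condition `l * M ≤ 1 / 4` puts every `l * ν i` in the range of the scalar
estimate. -/
theorem integral_exp_symmetric_le {ι : Type*} [Fintype ι] (b : OrthonormalBasis ι ℝ E)
    (S : E →ₗ[ℝ] E) (hS : S.IsSymmetric)
    {M : ℝ} (hM : ∀ x, |inner ℝ x (S x)| ≤ M * ‖x‖ ^ 2) {l : ℝ} (hl0 : 0 ≤ l)
    (hl : l * M ≤ 1 / 4) :
    Integrable (fun x => Real.exp (l * inner ℝ x (S x))) (stdGaussian E) ∧
    ∫ x, Real.exp (l * inner ℝ x (S x)) ∂(stdGaussian E) ≤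
      Real.exp (l * LinearMap.trace ℝ E S + 2 * l ^ 2 * ∑ i, ‖S (b i)‖ ^ 2) := by
  set e := hS.eigenvectorBasis rfl with he
  set ν := hS.eigenvalues rfl with hν
  have hSe : ∀ i, S (e i) = ν i • e i := fun i => by
    have := hS.apply_eigenvectorBasis rfl i
    rwa [RCLike.ofReal_real_eq_id, id] at this
  have hνM : ∀ i, |ν i| ≤ M := fun i => by
    have := hM (e i)
    rw [hSe, real_inner_smul_right, real_inner_self_eq_norm_sq] at this
    simpa using this
  have hlν : ∀ i, |l * ν i| ≤ 1 / 4 := fun i => by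
    rw [abs_mul, abs_of_nonneg hl0]
    exact (mul_le_mul_of_nonneg_left (hνM i) hl0).trans hl
  have hform : ∀ x : Fin (Module.finrank ℝ E) → ℝ,
      Real.exp (l * inner ℝ (∑ i, x i • e i) (S (∑ i, x i • e i)))
        = ∏ i, Real.exp (l * ν i * x i ^ 2) := fun x => by
    rw [← Real.exp_sum, map_sum, sum_inner]
    congr 1
    rw [Finset.mul_sum]
    refine Finset.sum_congr rfl fun i _ => ?_
    rw [inner_sum, Finset.sum_eq_single i]
    · rw [map_smul, hSe, real_inner_smul_left, real_inner_smul_right, real_inner_smul_right,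
        real_inner_self_eq_norm_sq]
      simp
      ring
    · intro j _ hj
      rw [map_smul, hSe, real_inner_smul_left, real_inner_smul_right, real_inner_smul_right,
        e.inner_eq_zero hj.symm]
      simp
    · simp
  have hmeas : Measurable (fun x : Fin (Module.finrank ℝ E) → ℝ => ∑ i, x i • e i) := by
    fun_prop
  have hcont : Continuous (fun x => Real.exp (l * inner ℝ x (S x))) := by
    have : Continuous S := S.continuous_of_finiteDimensional
    fun_prop
  have hint : Integrable (fun x : Fin (Module.finrank ℝ E) → ℝ =>
      ∏ i, Real.exp (l * ν i * x i ^ 2)) (Measure.pi fun _ => gaussianReal 0 1) :=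
    Integrable.fintype_prod (f := fun i x => Real.exp (l * ν i * x ^ 2)) fun i =>
      integrable_exp_mul_sq_gaussianReal (by linarith [(abs_le.1 (hlν i)).2])
  rw [stdGaussian_eq_map_pi_orthonormalBasis e]
  constructor
  · rw [integrable_map_measure hcont.aestronglyMeasurable hmeas.aemeasurable]
    refine hint.congr (Filter.Eventually.of_forall fun x => ?_)
    exact (hform x).symm
  · rw [integral_map hmeas.aemeasurable hcont.aestronglyMeasurable]
    simp_rw [hform]
    rw [integral_fintype_prod_eq_prod (f := fun i x => Real.exp (l * ν i * x ^ 2))]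
    calc ∏ i, ∫ x, Real.exp (l * ν i * x ^ 2) ∂(gaussianReal 0 1)
        ≤ ∏ i, Real.exp (l * ν i + 2 * (l * ν i) ^ 2) :=
          Finset.prod_le_prod (fun i _ => integral_nonneg fun _ => (Real.exp_pos _).le)
            fun i _ => integral_exp_mul_sq_gaussianReal_le (hlν i)
      _ = Real.exp (l * LinearMap.trace ℝ E S + 2 * l ^ 2 * ∑ i, ‖S (b i)‖ ^ 2) := by
          rw [← Real.exp_sum, LinearMap.trace_eq_sum_inner S e]
          congr 1
          have h2 : ∑ i, ‖S (b i)‖ ^ 2 = ∑ i, ν i ^ 2 := by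
            rw [← OrthonormalBasis.sum_norm_sq_adjoint b e S]
            refine Finset.sum_congr rfl fun i _ => ?_
            have hadj : LinearMap.adjoint S = S :=
              LinearMap.isSelfAdjoint_iff'.1 ((LinearMap.isSymmetric_iff_isSelfAdjoint S).1 hS)
            rw [hadj, hSe, norm_smul]
            simp
          rw [h2, Finset.sum_add_distrib, Finset.mul_sum, Finset.mul_sum]
          congr 1
          · refine Finset.sum_congr rfl fun i _ => ?_
            rw [hSe, real_inner_smul_right, real_inner_self_eq_norm_sq]
            simp
          · refine Finset.sum_congr rfl fun i _ => ?_
            ring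

/-- Symmetrizing `T` leaves the quadratic form and the trace unchanged and does not increase the
Hilbert–Schmidt norm. -/
theorem integral_exp_quadratic_le {ι : Type*} [Fintype ι] (b : OrthonormalBasis ι ℝ E)
    (T : E →ₗ[ℝ] E)
    {M : ℝ} (hM : ∀ x, |inner ℝ x (T x)| ≤ M * ‖x‖ ^ 2) {l : ℝ} (hl0 : 0 ≤ l)
    (hl : l * M ≤ 1 / 4) :
    Integrable (fun x => Real.exp (l * inner ℝ x (T x))) (stdGaussian E) ∧
    ∫ x, Real.exp (l * inner ℝ x (T x)) ∂(stdGaussian E) ≤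
      Real.exp (l * ∑ i, inner ℝ (b i) (T (b i)) + 2 * l ^ 2 * ∑ i, ‖T (b i)‖ ^ 2) := by
  set S : E →ₗ[ℝ] E := (1 / 2 : ℝ) • (T + LinearMap.adjoint T) with hSdef
  have hin : ∀ x, inner ℝ x (S x) = inner ℝ x (T x) := fun x => by
    simp only [hSdef, LinearMap.smul_apply, LinearMap.add_apply, real_inner_smul_right,
      inner_add_right, LinearMap.adjoint_inner_right]
    rw [real_inner_comm x (T x)]
    ring
  have hS : S.IsSymmetric := fun x y => by
    simp only [hSdef, LinearMap.smul_apply, LinearMap.add_apply, real_inner_smul_right,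
      real_inner_smul_left, inner_add_right, inner_add_left, LinearMap.adjoint_inner_right,
      LinearMap.adjoint_inner_left]
    ring
  obtain ⟨h1, h2⟩ := integral_exp_symmetric_le b S hS (M := M) (by simpa only [hin] using hM)
    hl0 hl
  simp only [hin] at h1 h2
  refine ⟨h1, h2.trans (Real.exp_le_exp.2 ?_)⟩
  rw [LinearMap.trace_eq_sum_inner S b]
  simp only [hin]
  have h3 : ∑ i, ‖S (b i)‖ ^ 2 ≤ ∑ i, ‖T (b i)‖ ^ 2 := by
    have hle : ∀ i, ‖S (b i)‖ ^ 2
        ≤ 1 / 2 * ‖T (b i)‖ ^ 2 + 1 / 2 * ‖LinearMap.adjoint T (b i)‖ ^ 2 := fun i => by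
      simp only [hSdef, LinearMap.smul_apply, LinearMap.add_apply, norm_smul]
      have := norm_add_le (T (b i)) (LinearMap.adjoint T (b i))
      have h4 := pow_le_pow_left₀ (norm_nonneg _) this 2
      rw [mul_pow]
      norm_num
      nlinarith [sq_nonneg (‖T (b i)‖ - ‖LinearMap.adjoint T (b i)‖)]
    refine (Finset.sum_le_sum fun i _ => hle i).trans ?_
    rw [Finset.sum_add_distrib, ← Finset.mul_sum, ← Finset.mul_sum,
      OrthonormalBasis.sum_norm_sq_adjoint b b T]
    linarith
  gcongr

/-- Chernoff bound for the quadratic form `⟪A x, B x⟫` of a standard Gaussian vector. -/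
theorem stdGaussian_inner_tail {ι : Type*} [Fintype ι] (b : OrthonormalBasis ι ℝ E)
    {F : Type*} [NormedAddCommGroup F] [InnerProductSpace ℝ F] [FiniteDimensional ℝ F]
    (A B : E →ₗ[ℝ] F) {p q V : ℝ} (hp0 : 0 ≤ p) (hA : ∀ x, ‖A x‖ ≤ p * ‖x‖)
    (hB : ∀ x, ‖B x‖ ≤ q * ‖x‖) (hV : ∑ i, ‖B (b i)‖ ^ 2 ≤ V) {l : ℝ} (hl0 : 0 ≤ l)
    (hl : l * (p * q) ≤ 1 / 4) (r : ℝ) :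
    (stdGaussian E).real {x | r ≤ inner ℝ (A x) (B x)} ≤
      Real.exp (-(l * r) + l * ∑ i, inner ℝ (A (b i)) (B (b i)) + 2 * l ^ 2 * (p ^ 2 * V)) := by
  -- The form is `⟪x, A* B x⟫`; the Hilbert–Schmidt norm of `A* B` is at most `p` times that of `B`.
  set T : E →ₗ[ℝ] E := LinearMap.adjoint A ∘ₗ B with hT
  have hin : ∀ x, inner ℝ x (T x) = inner ℝ (A x) (B x) := fun x => by
    rw [hT, LinearMap.comp_apply, LinearMap.adjoint_inner_right]
  have hadj : ∀ y, ‖LinearMap.adjoint A y‖ ≤ p * ‖y‖ := fun y => by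
    have h : ‖LinearMap.adjoint A y‖ * ‖LinearMap.adjoint A y‖
        ≤ p * ‖y‖ * ‖LinearMap.adjoint A y‖ := by
      rw [← real_inner_self_eq_norm_mul_norm, LinearMap.adjoint_inner_left]
      refine (real_inner_le_norm _ _).trans ?_
      have := mul_le_mul_of_nonneg_left (hA (LinearMap.adjoint A y)) (norm_nonneg y)
      linarith
    rcases (norm_nonneg (LinearMap.adjoint A y)).eq_or_lt with h0 | h0
    · rw [← h0]; positivity
    · exact le_of_mul_le_mul_right h h0
  obtain ⟨h1, h2⟩ := integral_exp_quadratic_le b T (M := p * q) (fun x => by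
    rw [hin]
    refine (abs_real_inner_le_norm _ _).trans ?_
    refine (mul_le_mul (hA x) (hB x) (norm_nonneg _) (by positivity)).trans (le_of_eq (by ring)))
    hl0 hl
  simp only [hin] at h1 h2
  refine (measure_ge_le_exp_mul_mgf r hl0 h1).trans ?_
  have h3 : ∑ i, ‖T (b i)‖ ^ 2 ≤ p ^ 2 * V := by
    refine le_trans ?_ (mul_le_mul_of_nonneg_left hV (sq_nonneg p))
    rw [Finset.mul_sum]
    refine Finset.sum_le_sum fun i _ => ?_
    rw [← mul_pow]
    exact pow_le_pow_left₀ (norm_nonneg _) (hadj _) 2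
  refine (mul_le_mul_of_nonneg_left h2 (Real.exp_pos _).le).trans ?_
  rw [← Real.exp_add]
  refine Real.exp_le_exp.2 ?_
  have : 2 * l ^ 2 * ∑ i, ‖T (b i)‖ ^ 2 ≤ 2 * l ^ 2 * (p ^ 2 * V) := by gcongr
  linarith

end QuadraticForm

/-! ### Tails of quadratic forms of the complex Gaussian noise -/

section Noise

variable {W : Type*} [NormedAddCommGroup W] [InnerProductSpace ℂ W]

/-- The complex sequence supported on `J` whose real and imaginary parts are listed by `x`. -/
noncomputable def complexOfPairs (J : Finset ℤ) (x : EuclideanSpace ℝ (J × Bool)) : ℤ → ℂ :=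
  fun j => if h : j ∈ J then (x (⟨j, h⟩, true) : ℂ) + x (⟨j, h⟩, false) * Complex.I else 0

theorem sum_norm_sq_complexOfPairs (J : Finset ℤ) (x : EuclideanSpace ℝ (J × Bool)) :
    ∑ j ∈ J, ‖complexOfPairs J x j‖ ^ 2 = ‖x‖ ^ 2 := by
  rw [EuclideanSpace.real_norm_sq_eq, Fintype.sum_prod_type, ← Finset.sum_coe_sort J]
  refine Finset.sum_congr rfl fun j _ => ?_
  simp only [complexOfPairs, j.2, dite_true, Fintype.sum_bool, Complex.sq_norm,
    Complex.normSq_add_mul_I]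

/-- The real-linear map `x ↦ ∑ j, z j • a j`, where `z` is the complex sequence listed by `x`. -/
noncomputable def pairsCombination (J : Finset ℤ) (a : ℤ → W) :
    EuclideanSpace ℝ (J × Bool) →ₗ[ℝ] W where
  toFun x := ∑ j ∈ J, complexOfPairs J x j • a j
  map_add' x y := by
    rw [← Finset.sum_add_distrib]
    refine Finset.sum_congr rfl fun j hj => ?_
    rw [← add_smul]
    congr 1
    simp only [complexOfPairs, hj, dite_true, PiLp.add_apply]
    push_cast
    ring
  map_smul' c x := by
    rw [Finset.smul_sum]
    refine Finset.sum_congr rfl fun j hj => ?_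
    rw [RingHom.id_apply, ← Complex.coe_smul, smul_smul]
    congr 1
    simp only [complexOfPairs, hj, dite_true, PiLp.smul_apply, smul_eq_mul]
    push_cast
    ring

theorem pairsCombination_apply (J : Finset ℤ) (a : ℤ → W) (x : EuclideanSpace ℝ (J × Bool)) :
    pairsCombination J a x = ∑ j ∈ J, complexOfPairs J x j • a j := rfl

theorem pairsCombination_basis (J : Finset ℤ) (a : ℤ → W) (p : J × Bool) :
    pairsCombination J a (EuclideanSpace.basisFun (J × Bool) ℝ p)
      = if p.2 then a p.1 else Complex.I • a p.1 := by
  obtain ⟨j, s⟩ := p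
  rw [pairsCombination_apply, Finset.sum_eq_single (j : ℤ)]
  · cases s <;> simp [complexOfPairs]
  · intro i hi hij
    have : (⟨i, hi⟩ : J) ≠ j := fun h => hij (by rw [← h])
    simp [complexOfPairs, hi, this]
  · simp

theorem sum_smul_norm_sq_le (J : Finset ℤ) (a : ℤ → W) (z : ℤ → ℂ) :
    ‖∑ j ∈ J, z j • a j‖ ^ 2 ≤ (∑ j ∈ J, ‖a j‖ ^ 2) * ∑ j ∈ J, ‖z j‖ ^ 2 := by
  refine (pow_le_pow_left₀ (norm_nonneg _) (norm_sum_le _ _) 2).trans ?_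
  simp only [norm_smul]
  rw [mul_comm]
  exact Finset.sum_mul_sq_le_sq_mul_sq _ _ _

variable {Ω : Type*} [MeasurableSpace Ω] {μ : Measure Ω} {ζ : ℤ → Ω → ℂ}

/-- The real and imaginary parts of the noise on `J`. -/
noncomputable def noisePairs (ζ : ℤ → Ω → ℂ) (J : Finset ℤ) (ω : Ω) :
    EuclideanSpace ℝ (J × Bool) :=
  WithLp.toLp 2 fun p => if p.2 then (ζ p.1 ω).re else (ζ p.1 ω).im

theorem complexOfPairs_noisePairs {Ω : Type*} {ζ : ℤ → Ω → ℂ} (J : Finset ℤ) (ω : Ω) {j : ℤ} (hj : j ∈ J) :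
    complexOfPairs J (noisePairs ζ J ω) j = ζ j ω := by
  simp [complexOfPairs, hj, noisePairs, Complex.re_add_im]

theorem IsStdComplexGaussianNoise.measurable_noisePairs (hζ : IsStdComplexGaussianNoise μ ζ)
    (J : Finset ℤ) : Measurable (noisePairs ζ J) := by
  refine (WithLp.measurable_toLp 2 _).comp (measurable_pi_lambda _ fun p => ?_)
  have h1 := Complex.measurable_re.comp (hζ.measurable p.1)
  have h2 := Complex.measurable_im.comp (hζ.measurable p.1)
  by_cases h : p.2 = true
  · simp only [h, if_true]; exact h1
  · simp only [h, if_false, Bool.false_eq_true]; exact h2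

theorem IsStdComplexGaussianNoise.map_noisePairs [IsProbabilityMeasure μ]
    (hζ : IsStdComplexGaussianNoise μ ζ)
    (J : Finset ℤ) : μ.map (noisePairs ζ J) = stdGaussian (EuclideanSpace ℝ (J × Bool)) := by
  rw [← map_pi_eq_stdGaussian]
  have hm : ∀ p : J × Bool,
      Measurable (fun ω => if p.2 then (ζ p.1 ω).re else (ζ p.1 ω).im) := fun p => by
    have h1 := Complex.measurable_re.comp (hζ.measurable p.1)
    have h2 := Complex.measurable_im.comp (hζ.measurable p.1)
    by_cases h : p.2 = true
    · simp only [h, if_true]; exact h1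
    · simp only [h, if_false, Bool.false_eq_true]; exact h2
  have hinj : Function.Injective (fun p : J × Bool => ((p.1 : ℤ), p.2)) := fun p q h => by
    simp only [Prod.mk.injEq] at h
    exact Prod.ext (Subtype.ext h.1) h.2
  have hind := hζ.indep.precomp hinj
  have := hind.map_fun_eq_pi_map (fun p => (hm p).aemeasurable)
  have hlaw : (fun p : J × Bool => μ.map
      (fun ω => if p.2 then (ζ p.1 ω).re else (ζ p.1 ω).im)) = fun _ => gaussianReal 0 1 := by
    funext p
    by_cases h : p.2 = true
    · simpa [h] using hζ.law_re p.1
    · simpa [h] using hζ.law_im p.1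
  have h2 : μ.map (fun ω (p : J × Bool) => if p.2 then (ζ p.1 ω).re else (ζ p.1 ω).im)
      = Measure.pi fun _ => gaussianReal 0 1 := by
    rw [← hlaw]; exact this
  rw [← h2, Measure.map_map (WithLp.measurable_toLp 2 _) (measurable_pi_lambda _ hm)]
  rfl

/-- This is the real Chernoff bound for the realified maps. The basis vectors for the real and
imaginary parts of `z j` contribute equally, which doubles both the trace and the squared
Hilbert–Schmidt norm. -/
theorem IsStdComplexGaussianNoise.inner_tail [FiniteDimensional ℂ W]
    [IsProbabilityMeasure μ]
    (hζ : IsStdComplexGaussianNoise μ ζ) (J : Finset ℤ) (a b : ℤ → W) {p q V : ℝ} (hp : 0 ≤ p)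
    (hq : 0 ≤ q)
    (ha : ∀ z : ℤ → ℂ, ‖∑ j ∈ J, z j • a j‖ ^ 2 ≤ p ^ 2 * ∑ j ∈ J, ‖z j‖ ^ 2)
    (hb : ∀ z : ℤ → ℂ, ‖∑ j ∈ J, z j • b j‖ ^ 2 ≤ q ^ 2 * ∑ j ∈ J, ‖z j‖ ^ 2)
    (hV : ∑ j ∈ J, ‖b j‖ ^ 2 ≤ V) {l : ℝ} (hl0 : 0 ≤ l) (hl : l * (p * q) ≤ 1 / 4) (r : ℝ) :
    μ.real {ω | r ≤ (inner ℂ (∑ j ∈ J, ζ j ω • a j) (∑ j ∈ J, ζ j ω • b j)).re} ≤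
      Real.exp (-(l * r) + 2 * l * (∑ j ∈ J, inner ℂ (a j) (b j)).re
        + 4 * l ^ 2 * p ^ 2 * V) := by
  have hnorm : ∀ (c : ℤ → W) (u : ℝ), 0 ≤ u →
      (∀ z : ℤ → ℂ, ‖∑ j ∈ J, z j • c j‖ ^ 2 ≤ u ^ 2 * ∑ j ∈ J, ‖z j‖ ^ 2) →
      ∀ x, ‖pairsCombination J c x‖ ≤ u * ‖x‖ := fun c u hu hc x => by
    refine le_of_sq_le_sq ?_ (by positivity)
    rw [pairsCombination_apply, mul_pow, ← sum_norm_sq_complexOfPairs]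
    exact hc _
  have hIn : ∀ v : W, ‖Complex.I • v‖ = ‖v‖ := fun v => by simp [norm_smul]
  have hV' : ∑ i, ‖pairsCombination J b (EuclideanSpace.basisFun (J × Bool) ℝ i)‖ ^ 2
      ≤ 2 * V := by
    simp only [pairsCombination_basis, Fintype.sum_prod_type, Fintype.sum_bool, if_true, hIn,
      Bool.false_eq_true, if_false]
    rw [Finset.sum_coe_sort J (fun j => ‖b j‖ ^ 2 + ‖b j‖ ^ 2), Finset.sum_add_distrib]
    linarith
  let _ : InnerProductSpace ℝ W := InnerProductSpace.rclikeToReal ℂ W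
  have hre : ∀ x y : W, (inner ℝ x y : ℝ) = (inner ℂ x y).re := fun _ _ => rfl
  have htr : ∑ i, inner ℝ (pairsCombination J a (EuclideanSpace.basisFun (J × Bool) ℝ i))
      (pairsCombination J b (EuclideanSpace.basisFun (J × Bool) ℝ i))
      = 2 * (∑ j ∈ J, inner ℂ (a j) (b j)).re := by
    have hII : ∀ v w : W, inner ℂ (Complex.I • v) (Complex.I • w) = inner ℂ v w := fun v w => by
      rw [inner_smul_left, inner_smul_right, ← mul_assoc]; simp
    simp only [pairsCombination_basis, Fintype.sum_prod_type, Fintype.sum_bool, if_true,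
      Bool.false_eq_true, if_false, hre, hII]
    rw [Finset.sum_coe_sort J (fun j => (inner ℂ (a j) (b j)).re
      + (inner ℂ (a j) (b j)).re), Finset.sum_add_distrib, Complex.re_sum]
    ring
  have key := stdGaussian_inner_tail (EuclideanSpace.basisFun (J × Bool) ℝ)
    (pairsCombination J a) (pairsCombination J b) hp (hnorm a p hp ha) (hnorm b q hq hb) hV'
    hl0 hl r
  rw [htr, ← hζ.map_noisePairs J, map_measureReal_apply (hζ.measurable_noisePairs J)] at key
  · have hcomb : ∀ (c : ℤ → W) ω, pairsCombination J c (noisePairs ζ J ω)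
        = ∑ j ∈ J, ζ j ω • c j := fun c ω => by
      rw [pairsCombination_apply]
      exact Finset.sum_congr rfl fun j hj => by rw [complexOfPairs_noisePairs J ω hj]
    simp only [Set.preimage_ofPred_eq, hcomb, hre] at key
    refine key.trans (Real.exp_le_exp.2 (le_of_eq ?_))
    ring
  · refine measurableSet_le measurable_const ?_
    have h1 : Continuous (pairsCombination J a) :=
      (pairsCombination J a).continuous_of_finiteDimensional
    have h2 : Continuous (pairsCombination J b) :=
      (pairsCombination J b).continuous_of_finiteDimensional
    exact (h1.inner h2).measurable

/-- Chi-square type tail: `V` bounds the squared Hilbert–Schmidt norm and `p` the operator norm of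
the linear map `z ↦ ∑ j, z j • a j`. -/
theorem IsStdComplexGaussianNoise.norm_sq_tail [FiniteDimensional ℂ W]
    [IsProbabilityMeasure μ]
    (hζ : IsStdComplexGaussianNoise μ ζ) (J : Finset ℤ) (a : ℤ → W) {p V : ℝ} (hp : 0 < p)
    (ha : ∀ z : ℤ → ℂ, ‖∑ j ∈ J, z j • a j‖ ^ 2 ≤ p ^ 2 * ∑ j ∈ J, ‖z j‖ ^ 2)
    (hV : ∑ j ∈ J, ‖a j‖ ^ 2 ≤ V) {β : ℝ} (hβ : 0 < β) :
    μ.real {ω | 4 * (V + p ^ 2 * Real.log (1 / β)) ≤ ‖∑ j ∈ J, ζ j ω • a j‖ ^ 2} ≤ β := by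
  -- The largest admissible `l`. The trace and variance terms then cost `V / (2 p²)` and `V / (4
  -- p²)`, both paid for by the `-V / p²` coming from the threshold.
  have h := hζ.inner_tail J a a hp.le hp.le ha ha hV (l := 1 / (4 * p ^ 2)) (by positivity)
    (le_of_eq (by field_simp)) (4 * (V + p ^ 2 * Real.log (1 / β)))
  have hin : ∀ v : W, (inner ℂ v v).re = ‖v‖ ^ 2 := fun v => by
    rw [inner_self_eq_norm_sq_to_K]; norm_cast
  simp only [hin, Complex.re_sum] at h
  refine h.trans ?_
  refine (Real.le_log_iff_exp_le hβ).1 ?_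
  rw [one_div β, Real.log_inv]
  have h1 : 2 * (1 / (4 * p ^ 2)) * ∑ j ∈ J, ‖a j‖ ^ 2 ≤ V / (2 * p ^ 2) := by
    rw [show V / (2 * p ^ 2) = 2 * (1 / (4 * p ^ 2)) * V by field_simp; norm_num]
    gcongr
  have hV0 : 0 ≤ V / p ^ 2 := by
    have : 0 ≤ V := (Finset.sum_nonneg fun j _ => sq_nonneg ‖a j‖).trans hV
    positivity
  have h2 : -(1 / (4 * p ^ 2) * (4 * (V + p ^ 2 * -Real.log β))) = Real.log β - V / p ^ 2 := by
    field_simp; ring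
  have h3 : 4 * (1 / (4 * p ^ 2)) ^ 2 * p ^ 2 * V = 1 / 4 * (V / p ^ 2) := by
    field_simp
  have h4 : V / (2 * p ^ 2) = 1 / 2 * (V / p ^ 2) := by field_simp
  rw [h2, h3]
  linarith

/-- Chi-square type tail with the Hilbert–Schmidt norm only. -/
theorem IsStdComplexGaussianNoise.norm_sq_tail_hilbertSchmidt [FiniteDimensional ℂ W]
    [IsProbabilityMeasure μ]
    (hζ : IsStdComplexGaussianNoise μ ζ) (J : Finset ℤ) (a : ℤ → W) {V : ℝ}
    (hV : ∑ j ∈ J, ‖a j‖ ^ 2 ≤ V) {β : ℝ} (hβ : 0 < β) :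
    μ.real {ω | 4 * V * (1 + Real.log (1 / β)) < ‖∑ j ∈ J, ζ j ω • a j‖ ^ 2} ≤ β := by
  have hV0 : 0 ≤ V := (Finset.sum_nonneg fun j _ => sq_nonneg ‖a j‖).trans hV
  have hs : ∀ z : ℤ → ℂ, ‖∑ j ∈ J, z j • a j‖ ^ 2 ≤ (√V) ^ 2 * ∑ j ∈ J, ‖z j‖ ^ 2 := fun z => by
    rw [Real.sq_sqrt hV0]
    refine (sum_smul_norm_sq_le J a z).trans ?_
    gcongr
  -- The previous tail needs `p = √V > 0`; for `V = 0` the sum vanishes identically.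
  rcases hV0.eq_or_lt with h0 | h0
  · have : {ω | 4 * V * (1 + Real.log (1 / β)) < ‖∑ j ∈ J, ζ j ω • a j‖ ^ 2} = ∅ := by
      ext ω
      simp only [Set.mem_ofPred_eq, Set.mem_empty_iff_false, iff_false, not_lt]
      refine (hs fun j => ζ j ω).trans ?_
      simp [← h0]
    rw [this]
    simpa using hβ.le
  · refine le_trans (measureReal_mono ?_) (hζ.norm_sq_tail J a (Real.sqrt_pos.2 h0) hs hV hβ)
    intro ω hω
    simp only [Set.mem_ofPred_eq, Real.sq_sqrt hV0] at hω ⊢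
    linarith

/-- Tail of the sesquilinear form `⟪∑ z j • a j, ∑ z j • b j⟫`, for a contraction
`z ↦ ∑ z j • a j`. -/
theorem IsStdComplexGaussianNoise.norm_inner_tail [FiniteDimensional ℂ W]
    [IsProbabilityMeasure μ]
    (hζ : IsStdComplexGaussianNoise μ ζ) (J : Finset ℤ) (a b : ℤ → W) {V τ : ℝ} (hV0 : 0 < V)
    (ha : ∀ z : ℤ → ℂ, ‖∑ j ∈ J, z j • a j‖ ^ 2 ≤ ∑ j ∈ J, ‖z j‖ ^ 2)
    (hV : ∑ j ∈ J, ‖b j‖ ^ 2 ≤ V) (hτ : ‖∑ j ∈ J, inner ℂ (a j) (b j)‖ ≤ τ)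
    {β : ℝ} (hβ : 0 < β) :
    μ.real {ω | 4 * τ + 8 * √V * (1 + Real.log (1 / β)) <
      ‖inner ℂ (∑ j ∈ J, ζ j ω • a j) (∑ j ∈ J, ζ j ω • b j)‖} ≤ 4 * β := by
  have hs : ∀ z : ℤ → ℂ, ‖∑ j ∈ J, z j • b j‖ ^ 2 ≤ (√V) ^ 2 * ∑ j ∈ J, ‖z j‖ ^ 2 := fun z => by
    rw [Real.sq_sqrt hV0.le]
    refine (sum_smul_norm_sq_le J b z).trans ?_
    gcongr
  have hsV : 0 < √V := Real.sqrt_pos.2 hV0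
  set R := 2 * τ + 4 * √V * (1 + Real.log (1 / β)) with hR
  -- Rotating by `c = 1, -1, I, -I` controls the real and imaginary parts from both sides. This
  -- accounts for the four copies of `β`, and for a modulus threshold of `2 * R`.
  have key : ∀ c : ℂ, ‖c‖ = 1 → μ.real {ω | R ≤
      (c * inner ℂ (∑ j ∈ J, ζ j ω • a j) (∑ j ∈ J, ζ j ω • b j)).re} ≤ β := fun c hc => by
    have h := hζ.inner_tail J a (fun j => c • b j) (zero_le_one) hsV.le
      (by simpa using ha) (fun z => by
        have : ∑ j ∈ J, z j • c • b j = c • ∑ j ∈ J, z j • b j := by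
          rw [Finset.smul_sum]
          exact Finset.sum_congr rfl fun j _ => smul_comm _ _ _
        rw [this, norm_smul, hc, one_mul]
        exact hs z) (V := V) (by simpa [norm_smul, hc] using hV) (l := 1 / (4 * √V))
      (by positivity) (le_of_eq (by field_simp)) R
    have h1 : ∀ ω, ∑ j ∈ J, ζ j ω • c • b j = c • ∑ j ∈ J, ζ j ω • b j := fun ω => by
      rw [Finset.smul_sum]
      exact Finset.sum_congr rfl fun j _ => smul_comm _ _ _
    simp only [h1, inner_smul_right] at h
    refine h.trans ?_
    refine (Real.le_log_iff_exp_le hβ).1 ?_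
    rw [hR, one_div β, Real.log_inv, ← Finset.mul_sum]
    have h2 : (c * ∑ j ∈ J, inner ℂ (a j) (b j)).re ≤ τ := by
      refine (Complex.re_le_norm _).trans ?_
      rwa [norm_mul, hc, one_mul]
    have h3 : 2 * (1 / (4 * √V)) * (c * ∑ j ∈ J, inner ℂ (a j) (b j)).re
        ≤ 2 * (1 / (4 * √V)) * τ := by gcongr
    have h4 : 4 * (1 / (4 * √V)) ^ 2 * 1 ^ 2 * V = 1 / 4 := by
      nth_rewrite 2 [← Real.sq_sqrt hV0.le]
      field_simp
    have h5 : -(1 / (4 * √V) * (2 * τ + 4 * √V * (1 + -Real.log β)))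
        = - (2 * (1 / (4 * √V)) * τ) - 1 + Real.log β := by
      field_simp; ring
    rw [h4, h5]
    linarith
  set X := fun ω => (inner ℂ (∑ j ∈ J, ζ j ω • a j) (∑ j ∈ J, ζ j ω • b j)) with hX
  have hsub : {ω | 4 * τ + 8 * √V * (1 + Real.log (1 / β)) < ‖X ω‖} ⊆
      ({ω | R ≤ (1 * X ω).re} ∪ {ω | R ≤ (-1 * X ω).re}) ∪
      ({ω | R ≤ (Complex.I * X ω).re} ∪ {ω | R ≤ (-Complex.I * X ω).re}) := by
    intro ω hω
    simp only [Set.mem_ofPred_eq, Set.mem_union] at hω ⊢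
    by_contra hcon
    simp only [not_or, not_le, one_mul, neg_mul, Complex.neg_re, Complex.I_mul_re, neg_neg] at hcon
    obtain ⟨⟨c1, c2⟩, c3, c4⟩ := hcon
    have := Complex.norm_le_abs_re_add_abs_im (X ω)
    have h1 : |(X ω).re| < R := abs_lt.2 ⟨by linarith, c1⟩
    have h2 : |(X ω).im| < R := abs_lt.2 ⟨by linarith, c4⟩
    linarith
  refine (measureReal_mono hsub).trans ?_
  refine (measureReal_union_le _ _).trans ?_
  have e1 := measureReal_union_le (μ := μ) {ω | R ≤ (1 * X ω).re} {ω | R ≤ (-1 * X ω).re}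
  have e2 := measureReal_union_le (μ := μ) {ω | R ≤ (Complex.I * X ω).re}
    {ω | R ≤ (-Complex.I * X ω).re}
  linarith [key 1 (by simp), key (-1) (by simp), key Complex.I (by simp),
    key (-Complex.I) (by simp)]

end Noise

/-! ### Convolutions with finitely supported filters -/

theorem seqSupportedOn_mono {a b a' b' : ℤ} (ha : a' ≤ a) (hb : b ≤ b') :
    seqSupportedOn a b ⊆ seqSupportedOn a' b' := fun _ hu t ht =>
  hu t fun h => ht ⟨ha.trans h.1, h.2.trans hb⟩

theorem sum_Icc_sub {M : Type*} [AddCommMonoid M] (f : ℤ → M) (a b j : ℤ) :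
    ∑ t ∈ Finset.Icc a b, f (t - j) = ∑ i ∈ Finset.Icc (a - j) (b - j), f i := by
  refine Finset.sum_bij' (fun t _ => t - j) (fun i _ => i + j) ?_ ?_ ?_ ?_ ?_ <;>
    simp only [Finset.mem_Icc] <;> intros <;> first | omega | trivial

theorem sum_Icc_reflect {M : Type*} [AddCommMonoid M] (f : ℤ → M) (a b t : ℤ) :
    ∑ τ ∈ Finset.Icc a b, f (t - τ) = ∑ i ∈ Finset.Icc (t - b) (t - a), f i := by
  refine Finset.sum_bij' (fun τ _ => t - τ) (fun i _ => t - i) ?_ ?_ ?_ ?_ ?_ <;>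
    simp only [Finset.mem_Icc] <;> intros <;> first | omega | trivial

theorem sum_range_eq_sum_Icc {M : Type*} [AddCommMonoid M] (f : ℤ → M) (n : ℕ) :
    ∑ t ∈ Finset.range (n + 1), f t = ∑ t ∈ Finset.Icc (0 : ℤ) n, f t := by
  refine Finset.sum_bij' (fun t _ => (t : ℤ)) (fun i _ => i.toNat) ?_ ?_ ?_ ?_ ?_ <;>
    simp only [Finset.mem_Icc, Finset.mem_range] <;> intros <;> first | omega | trivial

theorem convSeq_eq_sum {u : ℤ → ℂ} {a b : ℤ} (hu : u ∈ seqSupportedOn a b) {J : Finset ℤ}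
    (hJ : Finset.Icc a b ⊆ J) (v : ℤ → ℂ) (t : ℤ) :
    convSeq u v t = ∑ τ ∈ J, u τ * v (t - τ) := by
  refine tsum_eq_sum fun τ hτ => ?_
  rw [hu τ fun h => hτ (hJ (Finset.mem_Icc.2 h)), zero_mul]

theorem convSeq_eq_sum_reflect {u : ℤ → ℂ} {a b : ℤ} (hu : u ∈ seqSupportedOn a b)
    {J : Finset ℤ} {t : ℤ} (hJ : Finset.Icc (t - b) (t - a) ⊆ J) (v : ℤ → ℂ) :
    convSeq u v t = ∑ j ∈ J, u (t - j) * v j := by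
  rw [convSeq_eq_sum hu subset_rfl]
  have := sum_Icc_reflect (fun j => u (t - j) * v j) a b t
  simp only [sub_sub_cancel] at this
  rw [this]
  refine Finset.sum_subset hJ fun j _ hj => ?_
  rw [hu (t - j) fun h => hj (Finset.mem_Icc.2 ⟨by linarith [h.2], by linarith [h.1]⟩), zero_mul]

theorem convSeq_mem_seqSupportedOn {u v : ℤ → ℂ} {a b c d : ℤ} (hu : u ∈ seqSupportedOn a b)
    (hv : v ∈ seqSupportedOn c d) : convSeq u v ∈ seqSupportedOn (a + c) (b + d) := by
  intro t ht
  rw [convSeq_eq_sum hu subset_rfl]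
  refine Finset.sum_eq_zero fun τ hτ => ?_
  rw [Finset.mem_Icc] at hτ
  rw [hv (t - τ) fun h => ht ⟨by linarith [h.1], by linarith [h.2]⟩, mul_zero]

theorem convSeq_add {u : ℤ → ℂ} {a b : ℤ} (hu : u ∈ seqSupportedOn a b) (v w : ℤ → ℂ) :
    convSeq u (v + w) = convSeq u v + convSeq u w := by
  funext t
  simp only [Pi.add_apply, convSeq_eq_sum hu subset_rfl, mul_add, Finset.sum_add_distrib]

theorem convSeq_sub {u : ℤ → ℂ} {a b : ℤ} (hu : u ∈ seqSupportedOn a b) (v w : ℤ → ℂ) :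
    convSeq u (v - w) = convSeq u v - convSeq u w := by
  funext t
  simp only [Pi.sub_apply, convSeq_eq_sum hu subset_rfl, mul_sub, Finset.sum_sub_distrib]

theorem convSeq_smul {u : ℤ → ℂ} {a b : ℤ} (hu : u ∈ seqSupportedOn a b) (c : ℂ) (v : ℤ → ℂ) :
    convSeq u (c • v) = c • convSeq u v := by
  funext t
  simp only [Pi.smul_apply, smul_eq_mul, convSeq_eq_sum hu subset_rfl, Finset.mul_sum]
  exact Finset.sum_congr rfl fun _ _ => by ring

theorem sub_convSeq {u w : ℤ → ℂ} {a b : ℤ} (hu : u ∈ seqSupportedOn a b)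
    (hw : w ∈ seqSupportedOn a b) (v : ℤ → ℂ) :
    convSeq (u - w) v = convSeq u v - convSeq w v := by
  have huw : u - w ∈ seqSupportedOn a b := fun t ht => by
    rw [Pi.sub_apply, hu t ht, hw t ht, sub_zero]
  funext t
  simp only [Pi.sub_apply, convSeq_eq_sum hu subset_rfl, convSeq_eq_sum hw subset_rfl,
    convSeq_eq_sum huw subset_rfl, sub_mul, Finset.sum_sub_distrib]

theorem convSeq_left_comm {u w : ℤ → ℂ} {a b c d : ℤ} (hu : u ∈ seqSupportedOn a b)
    (hw : w ∈ seqSupportedOn c d) (v : ℤ → ℂ) :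
    convSeq u (convSeq w v) = convSeq w (convSeq u v) := by
  funext t
  simp only [convSeq_eq_sum hu subset_rfl, convSeq_eq_sum hw subset_rfl, Finset.mul_sum]
  rw [Finset.sum_comm]
  refine Finset.sum_congr rfl fun i _ => Finset.sum_congr rfl fun j _ => ?_
  rw [sub_right_comm]
  ring

theorem convSeq_assoc {u w : ℤ → ℂ} {a b c d : ℤ} (hu : u ∈ seqSupportedOn a b)
    (hw : w ∈ seqSupportedOn c d) (v : ℤ → ℂ) :
    convSeq (convSeq u w) v = convSeq u (convSeq w v) := by
  funext t
  rw [convSeq_eq_sum (convSeq_mem_seqSupportedOn hu hw) subset_rfl]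
  simp only [convSeq_eq_sum hu subset_rfl, Finset.sum_mul]
  rw [Finset.sum_comm]
  refine Finset.sum_congr rfl fun i hi => ?_
  rw [Finset.mem_Icc] at hi
  have h := sum_Icc_sub (fun s => u i * w s * v (t - i - s)) (a + c) (b + d) i
  simp only [show ∀ s, t - i - (s - i) = t - s from fun s => by ring] at h
  rw [h, convSeq_eq_sum hw (J := Finset.Icc (a + c - i) (b + d - i))
    (Finset.Icc_subset_Icc (by linarith) (by linarith)), Finset.mul_sum]
  exact Finset.sum_congr rfl fun _ _ => by ring

theorem norm_convSeq_sq_le {u : ℤ → ℂ} {a b : ℤ} (hu : u ∈ seqSupportedOn a b) (v : ℤ → ℂ)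
    (t : ℤ) : ‖convSeq u v t‖ ^ 2 ≤
      (∑ τ ∈ Finset.Icc a b, ‖u τ‖ ^ 2) * ∑ j ∈ Finset.Icc (t - b) (t - a), ‖v j‖ ^ 2 := by
  rw [convSeq_eq_sum hu subset_rfl, ← sum_Icc_reflect (fun j => ‖v j‖ ^ 2)]
  refine (pow_le_pow_left₀ (norm_nonneg _) (norm_sum_le _ _) 2).trans ?_
  simp only [norm_mul]
  exact Finset.sum_mul_sq_le_sq_mul_sq _ _ _

theorem convSeq_shiftSeq_shiftSeq (h : ℤ) (u v : ℤ → ℂ) :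
    convSeq (shiftSeq (-h) u) (shiftSeq (-h) v) = shiftSeq (-(2 * h)) (convSeq u v) := by
  funext t
  simp only [convSeq, shiftSeq]
  rw [← (Equiv.subRight h).tsum_eq (fun τ => u (τ - -h) * v (t - τ - -h))]
  refine tsum_congr fun τ => ?_
  simp only [Equiv.subRight_apply]
  congr 2 <;> ring

theorem shiftSeq_mem_seqSupportedOn {u : ℤ → ℂ} {a b h : ℤ} (hu : u ∈ seqSupportedOn a b) :
    shiftSeq (-h) u ∈ seqSupportedOn (a - h) (b - h) := fun t ht =>
  hu _ fun h' => ht ⟨by linarith [h'.1], by linarith [h'.2]⟩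

/-! ### The discrete Fourier transform -/

/-- A geometric sum over a root of unity; `|d| ≤ n` excludes nonzero multiples of `n + 1`. -/
theorem sum_exp_eq_ite (n : ℕ) (d : ℤ) (hd : |d| ≤ n) :
    ∑ k ∈ Finset.range (n + 1), Complex.exp (2 * Real.pi * Complex.I * k * d / (n + 1))
      = if d = 0 then (n : ℂ) + 1 else 0 := by
  have hN : (n : ℂ) + 1 ≠ 0 := by exact_mod_cast Nat.succ_ne_zero n
  split_ifs with h
  · simp [h]
  · set w := Complex.exp (2 * Real.pi * Complex.I * d / (n + 1)) with hw
    have hpow : ∀ k : ℕ, Complex.exp (2 * Real.pi * Complex.I * k * d / (n + 1)) = w ^ k :=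
      fun k => by rw [hw, ← Complex.exp_nat_mul]; congr 1; ring
    have hw1 : w ≠ 1 := by
      rw [hw, Ne, Complex.exp_eq_one_iff]
      rintro ⟨l, hl⟩
      have h2 : (d : ℂ) = l * (n + 1) := by
        have hpi := Complex.two_pi_I_ne_zero
        field_simp at hl
        rw [hl, mul_comm]
      have h3 : d = l * (n + 1) := by exact_mod_cast h2
      rcases eq_or_ne l 0 with h0 | h0
      · exact h (by rw [h3, h0, zero_mul])
      · have : (1 : ℤ) ≤ |l| := Int.one_le_abs h0
        rw [h3, abs_mul, abs_of_nonneg (by positivity : (0 : ℤ) ≤ n + 1)] at hd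
        nlinarith
    have hwN : w ^ (n + 1) = 1 := by
      rw [hw, ← Complex.exp_nat_mul, Complex.exp_eq_one_iff]
      refine ⟨d, ?_⟩
      push_cast
      field_simp
    simp_rw [hpow]
    rw [geom_sum_eq hw1, hwN, sub_self, zero_div]

theorem abs_sub_le_of_mem_range {n s t : ℕ} (hs : s ∈ Finset.range (n + 1))
    (ht : t ∈ Finset.range (n + 1)) : |(s : ℤ) - t| ≤ n := by
  rw [Finset.mem_range] at hs ht
  rw [abs_le]
  omega

/-- Parseval's identity. -/
theorem sum_norm_sq_dftCoeff (n : ℕ) (u : ℤ → ℂ) :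
    ∑ k ∈ Finset.range (n + 1), ‖dftCoeff n u k‖ ^ 2
      = ∑ t ∈ Finset.range (n + 1), ‖u t‖ ^ 2 := by
  have hN : (n : ℂ) + 1 ≠ 0 := by exact_mod_cast Nat.succ_ne_zero n
  have hconj : ∀ k t : ℕ, (starRingEnd ℂ) (Complex.exp (2 * Real.pi * Complex.I * k * t / (n + 1)))
      = Complex.exp (-(2 * Real.pi * Complex.I * k * t / (n + 1))) := fun k t => by
    rw [← Complex.exp_conj]
    congr 1
    simp only [map_div₀, map_mul, map_add, map_one, map_ofNat, map_natCast, Complex.conj_ofReal,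
      Complex.conj_I]
    ring
  have hsq : ((((√((n : ℝ) + 1))⁻¹ : ℝ) : ℂ) * ((√((n : ℝ) + 1))⁻¹ : ℝ)) = ((n : ℂ) + 1)⁻¹ := by
    rw [← Complex.ofReal_mul, ← mul_inv, Real.mul_self_sqrt (by positivity)]
    push_cast; rfl
  have key : ∀ k : ℕ, ((‖dftCoeff n u k‖ ^ 2 : ℝ) : ℂ) = ((n : ℂ) + 1)⁻¹ *
      ∑ s ∈ Finset.range (n + 1), ∑ t ∈ Finset.range (n + 1), u s * (starRingEnd ℂ) (u t) *
        Complex.exp (2 * Real.pi * Complex.I * k * ((s - t : ℤ) : ℂ) / (n + 1)) := fun k => by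
    rw [← Complex.normSq_eq_norm_sq, ← Complex.mul_conj]
    simp only [dftCoeff, map_mul, map_sum, Complex.conj_ofReal, hconj]
    rw [mul_mul_mul_comm, hsq, Finset.sum_mul_sum]
    congr 1
    refine Finset.sum_congr rfl fun s _ => Finset.sum_congr rfl fun t _ => ?_
    rw [mul_mul_mul_comm, ← Complex.exp_add]
    congr 2
    push_cast
    ring
  have : ((∑ k ∈ Finset.range (n + 1), ‖dftCoeff n u k‖ ^ 2 : ℝ) : ℂ)
      = ((∑ t ∈ Finset.range (n + 1), ‖u t‖ ^ 2 : ℝ) : ℂ) := by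
    rw [Complex.ofReal_sum]
    simp_rw [key]
    rw [← Finset.mul_sum, Finset.sum_comm, Complex.ofReal_sum, Finset.mul_sum]
    refine Finset.sum_congr rfl fun s hs => ?_
    rw [Finset.sum_comm, Finset.sum_eq_single s]
    · rw [← Finset.mul_sum, sum_exp_eq_ite n _ (abs_sub_le_of_mem_range hs hs), sub_self,
        if_pos rfl, Complex.mul_conj, Complex.normSq_eq_norm_sq]
      field_simp
    · intro t ht hts
      rw [← Finset.mul_sum, sum_exp_eq_ite n _ (abs_sub_le_of_mem_range hs ht),
        if_neg (fun h => hts (by exact_mod_cast (sub_eq_zero.1 h).symm)), mul_zero]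
    · exact fun h => absurd hs h
  exact_mod_cast this

/-- The filter on `[0, n]` whose discrete Fourier transform is the `k`-th unit vector. -/
noncomputable def harmonicFilter (n k : ℕ) : ℤ → ℂ := fun τ =>
  if 0 ≤ τ ∧ τ ≤ n then ((√((n : ℝ) + 1))⁻¹ : ℝ) *
    Complex.exp (-(2 * Real.pi * Complex.I * k * τ / (n + 1))) else 0

theorem harmonicFilter_mem (n k : ℕ) : harmonicFilter n k ∈ seqSupportedOn 0 n := fun t ht => by
  exact if_neg ht

theorem norm_harmonicFilter_sq_le (n k : ℕ) (τ : ℤ) :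
    ‖harmonicFilter n k τ‖ ^ 2 ≤ ((n : ℝ) + 1)⁻¹ := by
  unfold harmonicFilter
  split_ifs
  · have : -(2 * Real.pi * Complex.I * k * τ / (n + 1))
        = ((-(2 * Real.pi * k * τ / (n + 1)) : ℝ) : ℂ) * Complex.I := by
      push_cast; ring
    rw [norm_mul, this, Complex.norm_exp_ofReal_mul_I, mul_one, Complex.norm_real, norm_inv,
      inv_pow, Real.norm_eq_abs, sq_abs, Real.sq_sqrt (by positivity)]
  · simp; positivity

theorem sum_norm_sq_harmonicFilter_le (n k : ℕ) (J : Finset ℤ) :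
    ∑ τ ∈ J, ‖harmonicFilter n k τ‖ ^ 2 ≤ 1 := by
  have h1 : ∑ τ ∈ J, ‖harmonicFilter n k τ‖ ^ 2
      ≤ ∑ τ ∈ Finset.Icc (0 : ℤ) n, ‖harmonicFilter n k τ‖ ^ 2 := by
    rw [← Finset.sum_filter_add_sum_filter_not J (fun τ => τ ∈ Finset.Icc (0 : ℤ) n)]
    have : ∑ τ ∈ J with τ ∉ Finset.Icc (0 : ℤ) n, ‖harmonicFilter n k τ‖ ^ 2 = 0 := by
      refine Finset.sum_eq_zero fun τ hτ => ?_
      rw [Finset.mem_filter, Finset.mem_Icc] at hτ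
      rw [harmonicFilter_mem n k τ hτ.2]
      simp
    rw [this, add_zero]
    refine Finset.sum_le_sum_of_subset_of_nonneg (fun τ hτ => (Finset.mem_filter.1 hτ).2)
      fun _ _ _ => sq_nonneg _
  refine h1.trans ?_
  rw [← sum_range_eq_sum_Icc (fun τ => ‖harmonicFilter n k τ‖ ^ 2)]
  refine (Finset.sum_le_card_nsmul _ (fun t : ℕ => ‖harmonicFilter n k t‖ ^ 2) _
    fun t _ => norm_harmonicFilter_sq_le n k t).trans ?_
  rw [Finset.card_range, nsmul_eq_mul]
  push_cast
  rw [mul_inv_cancel₀ (by positivity)]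

/-- Fourier inversion. -/
theorem sum_dftCoeff_mul_harmonicFilter {n : ℕ} {u : ℤ → ℂ} (hu : u ∈ seqSupportedOn 0 n)
    (τ : ℤ) : ∑ k ∈ Finset.range (n + 1), dftCoeff n u k * harmonicFilter n k τ = u τ := by
  by_cases hτ : τ ∈ Set.Icc (0 : ℤ) n
  swap
  · rw [hu τ hτ]
    exact Finset.sum_eq_zero fun k _ => by rw [harmonicFilter_mem n k τ hτ, mul_zero]
  obtain ⟨s, rfl⟩ := Int.eq_ofNat_of_zero_le hτ.1
  have hs : s ∈ Finset.range (n + 1) := by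
    have := hτ.2
    rw [Finset.mem_range]
    omega
  have hN : (n : ℂ) + 1 ≠ 0 := by exact_mod_cast Nat.succ_ne_zero n
  have hsq : ((((√((n : ℝ) + 1))⁻¹ : ℝ) : ℂ) * ((√((n : ℝ) + 1))⁻¹ : ℝ)) = ((n : ℂ) + 1)⁻¹ := by
    rw [← Complex.ofReal_mul, ← mul_inv, Real.mul_self_sqrt (by positivity)]
    push_cast; rfl
  have key : ∀ k : ℕ, dftCoeff n u k * harmonicFilter n k s = ((n : ℂ) + 1)⁻¹ *
      ∑ t ∈ Finset.range (n + 1), u t *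
        Complex.exp (2 * Real.pi * Complex.I * k * ((t - s : ℤ) : ℂ) / (n + 1)) := fun k => by
    rw [harmonicFilter, if_pos ⟨hτ.1, hτ.2⟩, dftCoeff, mul_mul_mul_comm, hsq, Finset.sum_mul]
    congr 1
    refine Finset.sum_congr rfl fun t _ => ?_
    rw [mul_assoc, ← Complex.exp_add]
    congr 2
    push_cast
    ring
  simp_rw [key]
  rw [← Finset.mul_sum, Finset.sum_comm, Finset.sum_eq_single s]
  · rw [← Finset.mul_sum, sum_exp_eq_ite n _ (abs_sub_le_of_mem_range hs hs), sub_self, if_pos rfl]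
    field_simp
  · intro t ht hts
    rw [← Finset.mul_sum, sum_exp_eq_ite n _ (abs_sub_le_of_mem_range ht hs),
      if_neg (fun h => hts (by exact_mod_cast sub_eq_zero.1 h)), mul_zero]
  · exact fun h => absurd hs h

/-- Decomposition of a convolution along the harmonic filters. -/
theorem convSeq_eq_sum_dftCoeff {n : ℕ} {H : ℤ} {u : ℤ → ℂ} (hu : u ∈ seqSupportedOn H (n + H))
    (v : ℤ → ℂ) (t : ℤ) : convSeq u v t = ∑ k ∈ Finset.range (n + 1),
      dftCoeff n (shiftSeq (-H) u) k * convSeq (harmonicFilter n k) v (t - H) := by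
  have hu' : shiftSeq (-H) u ∈ seqSupportedOn 0 n := by
    have := shiftSeq_mem_seqSupportedOn (h := H) hu
    simpa using this
  simp only [convSeq_eq_sum (harmonicFilter_mem n _) subset_rfl, Finset.mul_sum]
  rw [Finset.sum_comm, convSeq_eq_sum hu subset_rfl]
  have h := sum_Icc_sub (fun τ => u (τ + H) * v (t - (τ + H))) H (n + H) H
  simp only [sub_add_cancel, sub_self, add_sub_cancel_right] at h
  rw [h]
  refine Finset.sum_congr rfl fun τ _ => ?_
  have h2 := sum_dftCoeff_mul_harmonicFilter hu' τ
  rw [shiftSeq, sub_neg_eq_add] at h2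
  rw [← h2, Finset.sum_mul]
  refine Finset.sum_congr rfl fun k _ => ?_
  rw [show t - H - τ = t - (τ + H) by ring]
  ring

/-- Parseval's identity for the convolutions with the harmonic filters. -/
theorem sum_norm_sq_convSeq_harmonicFilter (n : ℕ) (v : ℤ → ℂ) (t : ℤ) :
    ∑ k ∈ Finset.range (n + 1), ‖convSeq (harmonicFilter n k) v t‖ ^ 2
      = ∑ τ ∈ Finset.range (n + 1), ‖v (t - τ)‖ ^ 2 := by
  have h := sum_norm_sq_dftCoeff n (fun τ => (starRingEnd ℂ) (v (t - τ)))
  simp only [RCLike.norm_conj] at h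
  rw [← h]
  refine Finset.sum_congr rfl fun k _ => ?_
  congr 1
  rw [← RCLike.norm_conj]
  congr 1
  rw [convSeq_eq_sum (harmonicFilter_mem n k) subset_rfl,
    ← sum_range_eq_sum_Icc (fun τ => harmonicFilter n k τ * v (t - τ)), dftCoeff, map_sum,
    Finset.mul_sum]
  refine Finset.sum_congr rfl fun τ hτ => ?_
  have : (τ : ℤ) ≤ n := by rw [Finset.mem_range] at hτ; omega
  rw [harmonicFilter, if_pos ⟨by positivity, this⟩, map_mul, map_mul, Complex.conj_ofReal,
    ← Complex.exp_conj]
  simp only [map_div₀, map_mul, map_add, map_one, map_ofNat, map_natCast, Complex.conj_ofReal,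
      Complex.conj_I, map_neg, map_intCast]
  rw [mul_assoc, mul_comm (Complex.exp _)]
  congr 3
  push_cast
  ring

/-- The discrete Fourier transform takes a convolution without wrap-around to a product. -/
theorem dftCoeff_convSeq {m n : ℕ} (hn : n = 2 * m) {u v : ℤ → ℂ} (hu : u ∈ seqSupportedOn 0 m)
    (hv : v ∈ seqSupportedOn 0 m) (k : ℕ) :
    dftCoeff n (convSeq u v) k = (√((n : ℝ) + 1) : ℝ) * dftCoeff n u k * dftCoeff n v k := by
  have hN : √((n : ℝ) + 1) ≠ 0 := (Real.sqrt_pos.2 (by positivity)).ne'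
  set e : ℤ → ℂ := fun t => Complex.exp (2 * Real.pi * Complex.I * k * t / (n + 1)) with he
  have hd : ∀ w, dftCoeff n w k = ((√((n : ℝ) + 1))⁻¹ : ℝ) * ∑ t ∈ Finset.Icc (0 : ℤ) n, w t * e t :=
    fun w => by
      rw [← sum_range_eq_sum_Icc (fun t => w t * e t)]
      simp only [dftCoeff, he, Int.cast_natCast]
  have key : ∑ t ∈ Finset.Icc (0 : ℤ) n, convSeq u v t * e t
      = (∑ t ∈ Finset.Icc (0 : ℤ) n, u t * e t) * ∑ t ∈ Finset.Icc (0 : ℤ) n, v t * e t := by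
    have hmn : Finset.Icc (0 : ℤ) m ⊆ Finset.Icc (0 : ℤ) n :=
      Finset.Icc_subset_Icc le_rfl (by omega)
    have hres : ∀ w ∈ seqSupportedOn 0 (m : ℤ), ∀ J : Finset ℤ, Finset.Icc (0 : ℤ) m ⊆ J →
        ∑ t ∈ J, w t * e t = ∑ t ∈ Finset.Icc (0 : ℤ) m, w t * e t := fun w hw J hJ => by
      refine (Finset.sum_subset hJ fun t _ ht => ?_).symm
      rw [hw t fun h => ht (Finset.mem_Icc.2 h), zero_mul]
    rw [hres u hu _ hmn, hres v hv _ hmn]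
    simp only [convSeq_eq_sum hu subset_rfl, Finset.sum_mul]
    rw [Finset.sum_comm]
    refine Finset.sum_congr rfl fun j hj => ?_
    rw [Finset.mem_Icc] at hj
    -- This is where wrap-around is excluded: for `0 ≤ j ≤ m` and `n = 2 m`, the interval `[-j, n -
    -- j]` still contains `[0, m]`.
    rw [← hres v hv (Finset.Icc (0 - j) (n - j)) (Finset.Icc_subset_Icc (by omega) (by omega)),
      ← sum_Icc_sub (fun i => v i * e i), Finset.mul_sum]
    refine Finset.sum_congr rfl fun t _ => ?_
    have : e t = e j * e (t - j) := by
      simp only [he]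
      rw [← Complex.exp_add]
      congr 1
      push_cast
      ring
    rw [this]
    ring
  rw [hd, hd, hd, key]
  have : ((√((n : ℝ) + 1) : ℝ) : ℂ) ≠ 0 := by exact_mod_cast hN
  push_cast
  field_simp

/-- Squaring the filter squares its transform, so the ℓ₁ norm becomes an ℓ₂ norm and Parseval
applies. This is why the oracle is a self-convolution. -/
theorem dftNormOne_convSeq_self {m n : ℕ} (hn : n = 2 * m) {u : ℤ → ℂ}
    (hu : u ∈ seqSupportedOn 0 m) : dftNormOne n (convSeq u u)
      = √((n : ℝ) + 1) * ∑ t ∈ Finset.Icc (0 : ℤ) m, ‖u t‖ ^ 2 := by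
  have h1 : ∀ k, ‖dftCoeff n (convSeq u u) k‖ = √((n : ℝ) + 1) * ‖dftCoeff n u k‖ ^ 2 := fun k => by
    rw [dftCoeff_convSeq hn hu hu, norm_mul, norm_mul, Complex.norm_real, Real.norm_eq_abs,
      abs_of_nonneg (Real.sqrt_nonneg _)]
    ring
  simp only [dftNormOne, h1]
  rw [← Finset.mul_sum, sum_norm_sq_dftCoeff, sum_range_eq_sum_Icc (fun t => ‖u t‖ ^ 2)]
  congr 1
  refine (Finset.sum_subset (Finset.Icc_subset_Icc le_rfl (by omega)) fun t _ ht => ?_).symm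
  rw [hu t fun h => ht (Finset.mem_Icc.2 h)]
  simp

theorem dftNormOne_sub_le (n : ℕ) (u v : ℤ → ℂ) :
    dftNormOne n (u - v) ≤ dftNormOne n u + dftNormOne n v := by
  rw [dftNormOne, dftNormOne, dftNormOne, ← Finset.sum_add_distrib]
  refine Finset.sum_le_sum fun k _ => ?_
  have : dftCoeff n (u - v) k = dftCoeff n u k - dftCoeff n v k := by
    simp only [dftCoeff, Pi.sub_apply, sub_mul, Finset.sum_sub_distrib, mul_sub]
  rw [this]
  exact norm_sub_le _ _

theorem sum_norm_sq_le_dftNormOne_sq (n : ℕ) (u : ℤ → ℂ) :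
    ∑ t ∈ Finset.Icc (0 : ℤ) n, ‖u t‖ ^ 2 ≤ dftNormOne n u ^ 2 := by
  rw [← sum_range_eq_sum_Icc (fun t => ‖u t‖ ^ 2), ← sum_norm_sq_dftCoeff]
  exact Finset.sum_sq_le_sq_sum_of_nonneg fun _ _ => norm_nonneg _

/-! ### Consequences of predictability -/

theorem integral_sq_sub_stdGaussian {E : Type*} [NormedAddCommGroup E] [InnerProductSpace ℝ E]
    [FiniteDimensional ℝ E] [MeasurableSpace E] [BorelSpace E] (L : StrongDual ℝ E) (r : ℝ) :
    Integrable (fun x => (r - L x) ^ 2) (stdGaussian E) ∧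
      ∫ x, (r - L x) ^ 2 ∂(stdGaussian E) = r ^ 2 + ‖L‖ ^ 2 := by
  have hL2 : MemLp (fun x => L x) 2 (stdGaussian E) :=
    (IsGaussian.memLp_two_id (μ := stdGaussian E)).continuousLinearMap_comp L
  have hi1 : Integrable (fun x => L x) (stdGaussian E) := hL2.integrable one_le_two
  have hi2 : Integrable (fun x => L x ^ 2) (stdGaussian E) := hL2.integrable_sq
  have hvar : ∫ x, L x ^ 2 ∂(stdGaussian E) = ‖L‖ ^ 2 := by
    rw [← variance_dual_stdGaussian L, variance_of_integral_eq_zero hL2.aestronglyMeasurable.aemeasurable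
      (integral_strongDual_stdGaussian L)]
  have heq : ∀ x, (r - L x) ^ 2 = r ^ 2 - 2 * r * L x + L x ^ 2 := fun x => by ring
  simp only [heq]
  have hi3 : Integrable (fun x => r ^ 2 - 2 * r * L x) (stdGaussian E) :=
    (integrable_const _).sub (hi1.const_mul _)
  refine ⟨hi3.add hi2, ?_⟩
  rw [integral_add hi3 hi2, integral_sub (integrable_const _) (hi1.const_mul _),
    integral_const_mul, integral_strongDual_stdGaussian, hvar]
  simp

/-- The cross term has mean zero; the factor `2` is the second moment of each complex noise
variable. -/
theorem IsStdComplexGaussianNoise.integral_norm_sub_sq {Ω : Type*} [MeasurableSpace Ω]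
    {μ : Measure Ω} [IsProbabilityMeasure μ] {ζ : ℤ → Ω → ℂ} (hζ : IsStdComplexGaussianNoise μ ζ)
    (J : Finset ℤ) (c : ℤ → ℂ) (a : ℂ) :
    ∫ ω, ‖a - ∑ j ∈ J, ζ j ω * c j‖ ^ 2 ∂μ = ‖a‖ ^ 2 + 2 * ∑ j ∈ J, ‖c j‖ ^ 2 := by
  set A := pairsCombination J c
  set L₁ : StrongDual ℝ (EuclideanSpace ℝ (J × Bool)) :=
    LinearMap.toContinuousLinearMap (Complex.reLm ∘ₗ A) with hL₁
  set L₂ : StrongDual ℝ (EuclideanSpace ℝ (J × Bool)) :=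
    LinearMap.toContinuousLinearMap (Complex.imLm ∘ₗ A) with hL₂
  have h1 : ∀ ω, ‖a - ∑ j ∈ J, ζ j ω * c j‖ ^ 2 =
      (fun x => (a.re - L₁ x) ^ 2 + (a.im - L₂ x) ^ 2) (noisePairs ζ J ω) := fun ω => by
    have h2 : A (noisePairs ζ J ω) = ∑ j ∈ J, ζ j ω * c j := by
      rw [pairsCombination_apply]
      exact Finset.sum_congr rfl fun j hj => by
        rw [complexOfPairs_noisePairs J ω hj, smul_eq_mul]
    simp only [hL₁, hL₂, LinearMap.coe_toContinuousLinearMap', LinearMap.comp_apply, h2,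
      Complex.reLm_coe, Complex.imLm_coe]
    rw [← Complex.normSq_eq_norm_sq, Complex.normSq_apply, Complex.sub_re, Complex.sub_im]
    ring
  simp only [h1]
  rw [← integral_map (φ := noisePairs ζ J) (hζ.measurable_noisePairs J).aemeasurable
    (f := fun x => (a.re - L₁ x) ^ 2 + (a.im - L₂ x) ^ 2)
    (Continuous.aestronglyMeasurable (by fun_prop)), hζ.map_noisePairs J]
  obtain ⟨i1, e1⟩ := integral_sq_sub_stdGaussian L₁ a.re
  obtain ⟨i2, e2⟩ := integral_sq_sub_stdGaussian L₂ a.im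
  have hnorm : ‖L₁‖ ^ 2 + ‖L₂‖ ^ 2 = 2 * ∑ j ∈ J, ‖c j‖ ^ 2 := by
    rw [(EuclideanSpace.basisFun (J × Bool) ℝ).norm_dual L₁,
      (EuclideanSpace.basisFun (J × Bool) ℝ).norm_dual L₂, ← Finset.sum_add_distrib]
    have : ∀ i, L₁ (EuclideanSpace.basisFun (J × Bool) ℝ i) ^ 2
        + L₂ (EuclideanSpace.basisFun (J × Bool) ℝ i) ^ 2 = ‖c i.1‖ ^ 2 := fun i => by
      simp only [hL₁, hL₂, LinearMap.coe_toContinuousLinearMap', LinearMap.comp_apply,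
        Complex.reLm_coe, Complex.imLm_coe, A, pairsCombination_basis]
      rw [← Complex.normSq_eq_norm_sq, Complex.normSq_apply]
      split_ifs
      · ring
      · simp only [smul_eq_mul, Complex.I_mul_re, Complex.I_mul_im]
        ring
    simp only [this, Fintype.sum_prod_type, Fintype.sum_bool]
    rw [Finset.sum_coe_sort J (fun j => ‖c j‖ ^ 2 + ‖c j‖ ^ 2), Finset.sum_add_distrib]
    ring
  rw [integral_add i1 i2, e1, e2, ← hnorm, ← Complex.normSq_eq_norm_sq a, Complex.normSq_apply]
  ring

theorem observedSeq_eq (x : ℤ → ℂ) (σ : ℝ) (z : ℤ → ℂ) :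
    observedSeq x σ z = x + (σ : ℂ) • z := rfl

/-- The bias and the variance of a filter with small mean square prediction error. -/
theorem IsStdComplexGaussianNoise.bias_variance_le {Ω : Type*} [MeasurableSpace Ω]
    {μ : Measure Ω} [IsProbabilityMeasure μ] {ζ : ℤ → Ω → ℂ} (hζ : IsStdComplexGaussianNoise μ ζ)
    {σ : ℝ} (hσ : 0 < σ) {a b : ℤ} {φ : ℤ → ℂ} (hφ : φ ∈ seqSupportedOn a b) (x : ℤ → ℂ) (t : ℤ)
    {R : ℝ} (h : ∫ ω, ‖x t - convSeq φ (observedSeq x σ (fun τ => ζ τ ω)) t‖ ^ 2 ∂μ ≤ σ ^ 2 * R) :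
    ‖x t - convSeq φ x t‖ ^ 2 ≤ σ ^ 2 * R ∧ 2 * ∑ τ ∈ Finset.Icc a b, ‖φ τ‖ ^ 2 ≤ R := by
  have h1 : ∀ ω, x t - convSeq φ (observedSeq x σ (fun τ => ζ τ ω)) t
      = (x t - convSeq φ x t) - ∑ j ∈ Finset.Icc (t - b) (t - a), ζ j ω * (σ * φ (t - j)) :=
    fun ω => by
      rw [observedSeq_eq, convSeq_add hφ, convSeq_smul hφ, Pi.add_apply, Pi.smul_apply,
        convSeq_eq_sum_reflect hφ subset_rfl (fun τ => ζ τ ω), ← sub_sub, smul_eq_mul,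
        Finset.mul_sum]
      congr 1
      exact Finset.sum_congr rfl fun j _ => by ring
  simp only [h1] at h
  rw [hζ.integral_norm_sub_sq] at h
  have h2 : ∑ j ∈ Finset.Icc (t - b) (t - a), ‖(σ : ℂ) * φ (t - j)‖ ^ 2
      = σ ^ 2 * ∑ τ ∈ Finset.Icc a b, ‖φ τ‖ ^ 2 := by
    have := sum_Icc_reflect (fun j => ‖(σ : ℂ) * φ (t - j)‖ ^ 2) a b t
    simp only [sub_sub_cancel] at this
    rw [← this, Finset.mul_sum]
    refine Finset.sum_congr rfl fun τ _ => ?_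
    rw [norm_mul, Complex.norm_real, mul_pow, Real.norm_eq_abs, sq_abs]
  rw [h2] at h
  have hS : 0 ≤ ∑ τ ∈ Finset.Icc a b, ‖φ τ‖ ^ 2 := Finset.sum_nonneg fun _ _ => sq_nonneg _
  have hσ2 : 0 < σ ^ 2 := by positivity
  constructor
  · nlinarith [mul_nonneg hσ2.le hS]
  · nlinarith [sq_nonneg ‖x t - convSeq φ x t‖]

/-! ### Windows of sequences -/

/-- The window `(u H, …, u (n + H))` of a two-sided sequence, as a Euclidean vector. -/
noncomputable def window (n : ℕ) (H : ℤ) : (ℤ → ℂ) →ₗ[ℂ] EuclideanSpace ℂ (Fin (n + 1)) where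
  toFun u := WithLp.toLp 2 fun i => u ((i : ℕ) + H)
  map_add' _ _ := rfl
  map_smul' _ _ := rfl

theorem window_apply (n : ℕ) (H : ℤ) (u : ℤ → ℂ) (i : Fin (n + 1)) :
    window n H u i = u ((i : ℕ) + H) := rfl

theorem norm_window_sq (n : ℕ) (H : ℤ) (u : ℤ → ℂ) :
    ‖window n H u‖ ^ 2 = ∑ t ∈ Finset.Icc H (n + H), ‖u t‖ ^ 2 := by
  have h := sum_Icc_sub (fun i => ‖u (i + H)‖ ^ 2) H (n + H) H
  simp only [sub_add_cancel, sub_self, add_sub_cancel_right] at h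
  rw [EuclideanSpace.norm_sq_eq, h, ← sum_range_eq_sum_Icc (fun i => ‖u (i + H)‖ ^ 2),
    Finset.sum_range (fun i => ‖u ((i : ℤ) + H)‖ ^ 2)]
  rfl

theorem windowNorm_shiftSeq (n : ℕ) (H : ℤ) (u : ℤ → ℂ) :
    windowNorm n (shiftSeq (-H) u) = ‖window n H u‖ := by
  rw [windowNorm, ← Real.sqrt_sq (norm_nonneg (window n H u)), EuclideanSpace.norm_sq_eq,
    Finset.sum_range (fun i => ‖shiftSeq (-H) u i‖ ^ 2)]
  simp only [window_apply, shiftSeq, sub_neg_eq_add]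

theorem measurable_window (n : ℕ) (H : ℤ) : Measurable (window n H) :=
  (WithLp.measurable_toLp 2 _).comp (measurable_pi_lambda _ fun _ => measurable_pi_apply _)

theorem measurable_convSeq {u : ℤ → ℂ} {a b : ℤ} (hu : u ∈ seqSupportedOn a b) :
    Measurable (convSeq u) := by
  refine measurable_pi_lambda _ fun t => ?_
  have : (fun v => convSeq u v t) = fun v => ∑ τ ∈ Finset.Icc a b, u τ * v (t - τ) :=
    funext fun v => convSeq_eq_sum hu subset_rfl v t
  rw [this]
  exact Finset.measurable_sum _ fun τ _ => (measurable_pi_apply _).const_mul _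

/-- The window of the sequence `1_{t = j}`. -/
noncomputable def windowUnit (n : ℕ) (H j : ℤ) : EuclideanSpace ℂ (Fin (n + 1)) :=
  window n H (Pi.single j 1)

theorem windowUnit_apply (n : ℕ) (H j : ℤ) (i : Fin (n + 1)) :
    windowUnit n H j i = if (i : ℕ) + H = j then 1 else 0 := by
  rw [windowUnit, window_apply, Pi.single_apply]

theorem window_eq_sum {n : ℕ} {H : ℤ} {J : Finset ℤ} (hJ : Finset.Icc H (n + H) ⊆ J)
    (z : ℤ → ℂ) : window n H z = ∑ j ∈ J, z j • windowUnit n H j := by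
  ext i
  rw [window_apply, WithLp.ofLp_sum, Finset.sum_apply, Finset.sum_eq_single ((i : ℕ) + H)]
  · simp [windowUnit_apply]
  · intro j _ hj
    simp [windowUnit_apply, hj.symm]
  · intro h
    refine absurd (hJ (Finset.mem_Icc.2 ⟨by omega, ?_⟩)) h
    have := i.2
    omega

theorem norm_sq_sum_windowUnit_le {n : ℕ} {H : ℤ} (J : Finset ℤ) (z : ℤ → ℂ) :
    ‖∑ j ∈ J, z j • windowUnit n H j‖ ^ 2 ≤ ∑ j ∈ J, ‖z j‖ ^ 2 := by
  have h1 : ∀ i : Fin (n + 1), (∑ j ∈ J, z j • windowUnit n H j) i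
      = if (i : ℕ) + H ∈ J then z ((i : ℕ) + H) else 0 := fun i => by
    rw [WithLp.ofLp_sum, Finset.sum_apply, ← Finset.sum_ite_eq J ((i : ℕ) + H) z]
    refine Finset.sum_congr rfl fun j _ => ?_
    simp [windowUnit_apply]
  rw [EuclideanSpace.norm_sq_eq]
  simp only [h1]
  set S := Finset.univ.filter (fun i : Fin (n + 1) => ((i : ℕ) : ℤ) + H ∈ J) with hS
  have hinj : Set.InjOn (fun i : Fin (n + 1) => ((i : ℕ) : ℤ) + H) S := fun i _ j _ h => by
    have : ((i : ℕ) : ℤ) = (j : ℕ) := add_right_cancel h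
    exact Fin.ext (by exact_mod_cast this)
  calc ∑ i : Fin (n + 1), ‖if ((i : ℕ) : ℤ) + H ∈ J then z ((i : ℕ) + H) else 0‖ ^ 2
      = ∑ i ∈ S, ‖z ((i : ℕ) + H)‖ ^ 2 := by
        rw [hS, Finset.sum_filter]
        refine Finset.sum_congr rfl fun i _ => ?_
        split_ifs <;> simp
    _ = ∑ j ∈ S.image (fun i : Fin (n + 1) => ((i : ℕ) : ℤ) + H), ‖z j‖ ^ 2 :=
        (Finset.sum_image (f := fun j => ‖z j‖ ^ 2) hinj).symm
    _ ≤ ∑ j ∈ J, ‖z j‖ ^ 2 := Finset.sum_le_sum_of_subset_of_nonneg (fun j hj => by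
        obtain ⟨i, hi, rfl⟩ := Finset.mem_image.1 hj
        exact (Finset.mem_filter.1 hi).2) fun _ _ _ => sq_nonneg _

/-- A Bessel inequality. Unit sequences at points outside the window give zero vectors, so the
family need not be orthonormal; the proof is by duality from the contraction bound above. -/
theorem sum_norm_sq_inner_windowUnit_le {n : ℕ} {H : ℤ} (J : Finset ℤ)
    (w : EuclideanSpace ℂ (Fin (n + 1))) :
    ∑ j ∈ J, ‖inner ℂ w (windowUnit n H j)‖ ^ 2 ≤ ‖w‖ ^ 2 := by
  set z : ℤ → ℂ := fun j => inner ℂ (windowUnit n H j) w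
  have hz : ∀ j, ‖inner ℂ w (windowUnit n H j)‖ = ‖z j‖ := fun j => norm_inner_symm _ _
  simp only [hz]
  set X := ∑ j ∈ J, ‖z j‖ ^ 2 with hX
  have hX0 : 0 ≤ X := Finset.sum_nonneg fun _ _ => sq_nonneg _
  have h1 : ((X : ℝ) : ℂ) = inner ℂ (∑ j ∈ J, z j • windowUnit n H j) w := by
    rw [sum_inner, hX, Complex.ofReal_sum]
    refine Finset.sum_congr rfl fun j _ => ?_
    rw [inner_smul_left, ← Complex.normSq_eq_norm_sq, Complex.normSq_eq_conj_mul_self]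
  have h2 : X ≤ ‖∑ j ∈ J, z j • windowUnit n H j‖ * ‖w‖ := by
    have := norm_inner_le_norm (𝕜 := ℂ) (∑ j ∈ J, z j • windowUnit n H j) w
    rwa [← h1, Complex.norm_real, Real.norm_eq_abs, abs_of_nonneg hX0] at this
  have h3 := norm_sq_sum_windowUnit_le (n := n) (H := H) J z
  have h4 : X ^ 2 ≤ X * ‖w‖ ^ 2 :=
    (pow_le_pow_left₀ hX0 h2 2).trans (by rw [mul_pow]; gcongr)
  rcases hX0.eq_or_lt with h0 | h0
  · rw [← h0]; positivity
  · rw [pow_two] at h4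
    exact le_of_mul_le_mul_left h4 h0

/-- The squared Hilbert–Schmidt norm of a projection is its rank: Bessel is summed over an
orthonormal basis of `K`. -/
theorem sum_norm_sq_starProjection_windowUnit_le {n : ℕ} {H : ℤ} (J : Finset ℤ)
    (K : Submodule ℂ (EuclideanSpace ℂ (Fin (n + 1)))) :
    ∑ j ∈ J, ‖K.starProjection (windowUnit n H j)‖ ^ 2 ≤ Module.finrank ℂ K := by
  set b := stdOrthonormalBasis ℂ K
  have h1 : ∀ v, ‖K.starProjection v‖ ^ 2 = ∑ l, ‖inner ℂ (b l : EuclideanSpace ℂ (Fin (n + 1))) v‖ ^ 2 :=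
    fun v => by
      rw [Submodule.starProjection_apply, ← Submodule.coe_norm, ← b.sum_sq_norm_inner_right]
      refine Finset.sum_congr rfl fun l _ => ?_
      rw [Submodule.coe_inner, ← Submodule.starProjection_apply,
        ← Submodule.inner_starProjection_left_eq_right,
        Submodule.starProjection_eq_self_iff.2 (b l).2]
  simp only [h1]
  rw [Finset.sum_comm]
  refine (Finset.sum_le_sum fun l _ => sum_norm_sq_inner_windowUnit_le J _).trans ?_
  have : ∀ l, ‖(b l : EuclideanSpace ℂ (Fin (n + 1)))‖ = 1 := fun l => by
    rw [← Submodule.coe_norm]; exact b.orthonormal.1 l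
  simp [this]

/-! ### High-probability events -/

/-- `G` is a measurable set that contains the noise with probability at least `1 - β`. -/
def IsNoiseEvent {Ω : Type*} [MeasurableSpace Ω] (μ : Measure Ω) (ζ : ℤ → Ω → ℂ) (β : ℝ)
    (G : Set (ℤ → ℂ)) : Prop :=
  MeasurableSet G ∧ 1 - β ≤ μ.real {ω | (fun t => ζ t ω) ∈ G}

theorem IsNoiseEvent.mono {Ω : Type*} [MeasurableSpace Ω] {μ : Measure Ω} {ζ : ℤ → Ω → ℂ}
    {β β' : ℝ} {G : Set (ℤ → ℂ)} (h : IsNoiseEvent μ ζ β G)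
    (hβ : β ≤ β') : IsNoiseEvent μ ζ β' G := ⟨h.1, by linarith [h.2]⟩

theorem IsStdComplexGaussianNoise.measurable_path {Ω : Type*} [MeasurableSpace Ω] {μ : Measure Ω}
    {ζ : ℤ → Ω → ℂ} (hζ : IsStdComplexGaussianNoise μ ζ) :
    Measurable (fun ω t => ζ t ω) := measurable_pi_lambda _ hζ.measurable

section Events

variable {Ω : Type*} [MeasurableSpace Ω] {μ : Measure Ω} [IsProbabilityMeasure μ]
  {ζ : ℤ → Ω → ℂ}

theorem isNoiseEvent_iff_compl (hζ : IsStdComplexGaussianNoise μ ζ) {β : ℝ} {G : Set (ℤ → ℂ)}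
    (hG : MeasurableSet G) :
    IsNoiseEvent μ ζ β G ↔ μ.real {ω | (fun t => ζ t ω) ∉ G} ≤ β := by
  have h : MeasurableSet {ω | (fun t => ζ t ω) ∈ G} := hζ.measurable_path hG
  have h2 := probReal_compl_eq_one_sub (μ := μ) h
  have h3 : {ω | (fun t => ζ t ω) ∈ G}ᶜ = {ω | (fun t => ζ t ω) ∉ G} := rfl
  rw [h3] at h2
  constructor
  · intro h4
    linarith [h4.2]
  · intro h4
    exact ⟨hG, by linarith⟩

theorem IsStdComplexGaussianNoise.isNoiseEvent_le (hζ : IsStdComplexGaussianNoise μ ζ)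
    {β R : ℝ} {f : (ℤ → ℂ) → ℝ} (hf : Measurable f)
    (h : μ.real {ω | R < f fun t => ζ t ω} ≤ β) : IsNoiseEvent μ ζ β {z | f z ≤ R} := by
  rw [isNoiseEvent_iff_compl hζ (measurableSet_le hf measurable_const)]
  simpa only [Set.mem_ofPred_eq, not_le] using h

theorem IsStdComplexGaussianNoise.isNoiseEvent_inter (hζ : IsStdComplexGaussianNoise μ ζ)
    {β β' : ℝ} {G G' : Set (ℤ → ℂ)} (h : IsNoiseEvent μ ζ β G) (h' : IsNoiseEvent μ ζ β' G') :
    IsNoiseEvent μ ζ (β + β') (G ∩ G') := by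
  have h0 := (isNoiseEvent_iff_compl hζ h.1).1 h
  have h1 := (isNoiseEvent_iff_compl hζ h'.1).1 h'
  rw [isNoiseEvent_iff_compl hζ (h.1.inter h'.1)]
  refine (measureReal_mono (s₂ := {ω | (fun t => ζ t ω) ∉ G} ∪ {ω | (fun t => ζ t ω) ∉ G'})
    fun ω hω => ?_).trans ((measureReal_union_le _ _).trans (add_le_add h0 h1))
  by_contra hcon
  simp only [Set.mem_union, Set.mem_ofPred_eq, not_or, not_not] at hcon
  exact hω hcon

theorem IsStdComplexGaussianNoise.isNoiseEvent_biInter (hζ : IsStdComplexGaussianNoise μ ζ)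
    {κ : Type*} (I : Finset κ) {β : ℝ} {G : κ → Set (ℤ → ℂ)}
    (h : ∀ i ∈ I, IsNoiseEvent μ ζ β (G i)) : IsNoiseEvent μ ζ (I.card * β) (⋂ i ∈ I, G i) := by
  have hm : MeasurableSet (⋂ i ∈ I, G i) := Finset.measurableSet_biInter I fun i hi => (h i hi).1
  rw [isNoiseEvent_iff_compl hζ hm]
  refine (measureReal_mono (s₂ := ⋃ i ∈ I, {ω | (fun t => ζ t ω) ∉ G i}) (fun ω hω => ?_)
    (measure_ne_top _ _)).trans ?_
  · simp only [Set.mem_ofPred_eq, Set.mem_iInter, not_forall] at hω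
    obtain ⟨i, hi, hG⟩ := hω
    exact Set.mem_biUnion hi hG
  · refine (measureReal_biUnion_finset_le _ _).trans ?_
    rw [← nsmul_eq_mul]
    exact Finset.sum_le_card_nsmul _ _ _ fun i hi => (isNoiseEvent_iff_compl hζ (h i hi).1).1 (h i hi)

/-- Each row of the Toeplitz matrix of `z ↦ u * z` on `[c, d]` has squared norm `‖u‖₂²`, so `V`
bounds its squared Hilbert–Schmidt norm. -/
theorem IsStdComplexGaussianNoise.isNoiseEvent_convSeq (hζ : IsStdComplexGaussianNoise μ ζ)
    {u : ℤ → ℂ} {a b : ℤ} (hu : u ∈ seqSupportedOn a b) (c d : ℤ) {V β : ℝ}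
    (hV : ((Finset.Icc c d).card : ℝ) * ∑ τ ∈ Finset.Icc a b, ‖u τ‖ ^ 2 ≤ V) (hβ : 0 < β) :
    IsNoiseEvent μ ζ β {z | ∑ t ∈ Finset.Icc c d, ‖convSeq u z t‖ ^ 2
      ≤ 4 * V * (1 + Real.log (1 / β))} := by
  refine hζ.isNoiseEvent_le (Finset.measurable_sum _ fun t _ =>
    (((measurable_pi_apply t).comp (measurable_convSeq hu)).norm.pow_const 2)) ?_
  set J := Finset.Icc (c - b) (d - a) with hJ
  set A : ℤ → EuclideanSpace ℂ (Finset.Icc c d) :=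
    fun j => WithLp.toLp 2 fun t => u ((t : ℤ) - j) with hA
  have hVA : ∑ j ∈ J, ‖A j‖ ^ 2 ≤ V := by
    refine le_trans ?_ hV
    simp only [EuclideanSpace.norm_sq_eq, hA]
    rw [Finset.sum_comm, ← nsmul_eq_mul, ← Fintype.card_coe, ← Finset.card_univ]
    refine Finset.sum_le_card_nsmul _ _ _ fun t _ => ?_
    have h1 := sum_Icc_reflect (fun τ => ‖u τ‖ ^ 2) (c - b) (d - a) t
    rw [hJ, h1]
    have ht := Finset.mem_Icc.1 t.2
    refine (Finset.sum_subset (Finset.Icc_subset_Icc (by linarith) (by linarith))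
      fun τ _ hτ => ?_).symm.le
    rw [hu τ fun h => hτ (Finset.mem_Icc.2 h)]
    simp
  refine le_of_eq_of_le ?_ (hζ.norm_sq_tail_hilbertSchmidt J A hVA hβ)
  congr 1
  ext ω
  simp only [Set.mem_ofPred_eq]
  rw [EuclideanSpace.norm_sq_eq, Finset.sum_coe_sort (Finset.Icc c d)
    (fun t => ‖convSeq u (fun t => ζ t ω) t‖ ^ 2) |>.symm]
  have : ∀ t : Finset.Icc c d, (∑ j ∈ J, ζ j ω • A j) t = convSeq u (fun t => ζ t ω) t :=
    fun t => by
      have ht := Finset.mem_Icc.1 t.2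
      rw [convSeq_eq_sum_reflect hu (J := J) (Finset.Icc_subset_Icc (by linarith) (by linarith)),
        WithLp.ofLp_sum, Finset.sum_apply]
      refine Finset.sum_congr rfl fun j _ => ?_
      simp [hA, mul_comm]
  simp only [this]

variable {n : ℕ} {H : ℤ} (K : Submodule ℂ (EuclideanSpace ℂ (Fin (n + 1))))

theorem starProjection_window_eq_sum {J : Finset ℤ} (hJ : Finset.Icc H (n + H) ⊆ J)
    (z : ℤ → ℂ) : K.starProjection (window n H z)
      = ∑ j ∈ J, z j • K.starProjection (windowUnit n H j) := by
  rw [window_eq_sum hJ, map_sum]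
  simp only [map_smul]

theorem norm_sq_sum_starProjection_windowUnit_le (J : Finset ℤ) (z : ℤ → ℂ) :
    ‖∑ j ∈ J, z j • K.starProjection (windowUnit n H j)‖ ^ 2 ≤ ∑ j ∈ J, ‖z j‖ ^ 2 := by
  refine le_trans ?_ (norm_sq_sum_windowUnit_le (n := n) (H := H) J z)
  rw [show ∑ j ∈ J, z j • K.starProjection (windowUnit n H j)
    = K.starProjection (∑ j ∈ J, z j • windowUnit n H j) by rw [map_sum]; simp only [map_smul]]
  exact pow_le_pow_left₀ (norm_nonneg _) (K.norm_starProjection_apply_le _) 2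

theorem measurable_starProjection_window : Measurable (fun z => K.starProjection (window n H z)) :=
  K.starProjection.continuous.measurable.comp (measurable_window n H)

theorem IsStdComplexGaussianNoise.isNoiseEvent_starProjection
    (hζ : IsStdComplexGaussianNoise μ ζ) (H : ℤ) {β : ℝ} (hβ : 0 < β) :
    IsNoiseEvent μ ζ β {z | ‖K.starProjection (window n H z)‖ ^ 2
      ≤ 4 * (Module.finrank ℂ K + Real.log (1 / β))} := by
  refine hζ.isNoiseEvent_le ((measurable_starProjection_window K).norm.pow_const 2) ?_
  refine le_trans (measureReal_mono ?_) (hζ.norm_sq_tail (Finset.Icc H (n + H))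
    (fun j => K.starProjection (windowUnit n H j)) one_pos
    (by simpa using norm_sq_sum_starProjection_windowUnit_le K _)
    (sum_norm_sq_starProjection_windowUnit_le _ K) hβ)
  intro ω hω
  simp only [Set.mem_ofPred_eq, starProjection_window_eq_sum K subset_rfl] at hω ⊢
  linarith

/-- All indices are treated at once as a single Gaussian vector. No union bound is needed, so the
term in `ε` carries no logarithm of `n`. -/
theorem IsStdComplexGaussianNoise.isNoiseEvent_sum_inner
    (hζ : IsStdComplexGaussianNoise μ ζ) (H : ℤ) (N : ℕ)
    (e : ℕ → EuclideanSpace ℂ (Fin (n + 1))) {V β : ℝ} (hβ : 0 < β)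
    (hV : ∑ k ∈ Finset.range N, ‖e k‖ ^ 2 ≤ V) :
    IsNoiseEvent μ ζ β {z | ∑ k ∈ Finset.range N,
      ‖inner ℂ (K.starProjection (window n H z)) (e k)‖ ^ 2
        ≤ 4 * V * (1 + Real.log (1 / β))} := by
  refine hζ.isNoiseEvent_le (Finset.measurable_sum _ fun k _ =>
    (((measurable_starProjection_window K).inner measurable_const).norm.pow_const 2)) ?_
  set J := Finset.Icc H (n + H) with hJ
  -- The noise is put in the second, linear slot of the inner product; the conjugation disappears
  -- under the norm.
  set A : ℤ → EuclideanSpace ℂ (Fin N) :=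
    fun j => WithLp.toLp 2 fun k => inner ℂ (e k) (K.starProjection (windowUnit n H j)) with hA
  have hVA : ∑ j ∈ J, ‖A j‖ ^ 2 ≤ V := by
    refine le_trans ?_ hV
    have hAn : ∀ j, ‖A j‖ ^ 2
        = ∑ k : Fin N, ‖inner ℂ (e k) (K.starProjection (windowUnit n H j))‖ ^ 2 :=
      fun j => EuclideanSpace.norm_sq_eq _
    simp only [hAn]
    rw [Finset.sum_comm, Finset.sum_range (fun k => ‖e k‖ ^ 2)]
    refine Finset.sum_le_sum fun k _ => ?_
    simp only [← Submodule.inner_starProjection_left_eq_right]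
    exact (sum_norm_sq_inner_windowUnit_le J _).trans
      (pow_le_pow_left₀ (norm_nonneg _) (K.norm_starProjection_apply_le _) 2)
  refine le_of_eq_of_le ?_ (hζ.norm_sq_tail_hilbertSchmidt J A hVA hβ)
  congr 1
  ext ω
  simp only [Set.mem_ofPred_eq]
  rw [EuclideanSpace.norm_sq_eq, Finset.sum_range]
  have : ∀ k : Fin N, ‖(∑ j ∈ J, ζ j ω • A j) k‖
      = ‖inner ℂ (K.starProjection (window n H fun t => ζ t ω)) (e k)‖ := fun k => by
    rw [norm_inner_symm, starProjection_window_eq_sum K (J := J) subset_rfl, inner_sum,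
      WithLp.ofLp_sum, Finset.sum_apply]
    simp [hA, inner_smul_right]
  simp only [this]

/-- The form is quadratic in the noise, with a contraction on one side and a map of squared
Hilbert–Schmidt norm at most `n + 1` on the other. For the trace, `Kᗮ` is written as identity minus
`K`. The identity contributes at most `n + 1` filter entries of size `(n + 1)^(-1/2)`, and `K`
contributes at most `√s √(n + 1)` by Cauchy–Schwarz. -/
theorem IsStdComplexGaussianNoise.isNoiseEvent_inner_convSeq
    (hζ : IsStdComplexGaussianNoise μ ζ) {H : ℤ} (hH : 0 ≤ H) (k : ℕ) {s β : ℝ} (hs1 : 1 ≤ s)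
    (hs : (Module.finrank ℂ K : ℝ) ≤ s) (hβ : 0 < β) :
    IsNoiseEvent μ ζ (4 * β) {z | ‖inner ℂ (Kᗮ.starProjection (window n H z))
        (window n 0 (convSeq (harmonicFilter n k) z))‖
      ≤ 8 * √((n : ℝ) + 1) * (√s + (1 + Real.log (1 / β)))} := by
  have hmem := harmonicFilter_mem n k
  refine hζ.isNoiseEvent_le ((measurable_starProjection_window Kᗮ).inner
    ((measurable_window n 0).comp (measurable_convSeq hmem))).norm ?_
  -- A common index set: the filtered noise on `[0, n]` uses `[-n, n]`, the noise window uses `[H, n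
  -- + H]`.
  set J := Finset.Icc (-(n : ℤ)) (n + H) with hJ
  set B : ℤ → EuclideanSpace ℂ (Fin (n + 1)) :=
    fun j => window n 0 (fun t => harmonicFilter n k (t - j)) with hB
  have hBsum : ∀ z : ℤ → ℂ, window n 0 (convSeq (harmonicFilter n k) z) = ∑ j ∈ J, z j • B j :=
    fun z => by
      ext i
      have := i.2
      rw [WithLp.ofLp_sum, Finset.sum_apply, window_apply, convSeq_eq_sum_reflect hmem (J := J)
        (Finset.Icc_subset_Icc (by omega) (by omega))]
      refine Finset.sum_congr rfl fun j _ => ?_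
      simp [hB, window_apply, mul_comm]
  have hV : ∑ j ∈ J, ‖B j‖ ^ 2 ≤ (n : ℝ) + 1 := by
    simp only [EuclideanSpace.norm_sq_eq, hB, window_apply]
    rw [Finset.sum_comm]
    refine (Finset.sum_le_card_nsmul _ _ 1 fun i _ => ?_).trans (by simp)
    rw [sum_Icc_reflect (fun τ => ‖harmonicFilter n k τ‖ ^ 2)]
    exact sum_norm_sq_harmonicFilter_le n k _
  have hn1 : (0 : ℝ) < (n : ℝ) + 1 := by positivity
  have hdiag : ‖∑ j ∈ J, inner ℂ (windowUnit n H j) (B j)‖ ≤ √((n : ℝ) + 1) := by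
    have h1 : ∀ j, ‖inner ℂ (windowUnit n H j) (B j)‖
        ≤ ∑ i : Fin (n + 1), if ((i : ℕ) : ℤ) + H = j then (√((n : ℝ) + 1))⁻¹ else 0 := fun j => by
      rw [PiLp.inner_apply]
      refine norm_sum_le_of_le _ fun i _ => ?_
      rw [windowUnit_apply]
      split_ifs
      · rw [RCLike.inner_apply, map_one, mul_one]
        have := norm_harmonicFilter_sq_le n k ((i : ℕ) + 0 - j)
        rw [← Real.sqrt_inv]
        exact Real.le_sqrt_of_sq_le this
      · simp
    refine (norm_sum_le_of_le _ fun j _ => h1 j).trans ?_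
    rw [Finset.sum_comm]
    refine (Finset.sum_le_card_nsmul _ _ (√((n : ℝ) + 1))⁻¹ fun i _ => ?_).trans (le_of_eq ?_)
    · rw [Finset.sum_ite_eq]
      split_ifs
      · exact le_rfl
      · positivity
    · rw [Finset.card_univ, Fintype.card_fin, nsmul_eq_mul]
      push_cast
      nth_rewrite 1 [← Real.mul_self_sqrt hn1.le]
      field_simp
  have hproj : ‖∑ j ∈ J, inner ℂ (K.starProjection (windowUnit n H j)) (B j)‖
      ≤ √s * √((n : ℝ) + 1) := by
    refine (norm_sum_le_of_le _ fun j _ => norm_inner_le_norm _ _).trans ?_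
    refine (Real.sum_mul_le_sqrt_mul_sqrt _ _ _).trans ?_
    gcongr
    exact (sum_norm_sq_starProjection_windowUnit_le _ K).trans hs
  have hτ : ‖∑ j ∈ J, inner ℂ (Kᗮ.starProjection (windowUnit n H j)) (B j)‖
      ≤ 2 * (√s * √((n : ℝ) + 1)) := by
    have h1 : ∑ j ∈ J, inner ℂ (Kᗮ.starProjection (windowUnit n H j)) (B j)
        = ∑ j ∈ J, inner ℂ (windowUnit n H j) (B j)
          - ∑ j ∈ J, inner ℂ (K.starProjection (windowUnit n H j)) (B j) := by
      rw [← Finset.sum_sub_distrib]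
      refine Finset.sum_congr rfl fun j _ => ?_
      rw [← inner_sub_left]
      congr 1
      exact eq_sub_of_add_eq' (Submodule.starProjection_add_starProjection_orthogonal _)
    rw [h1]
    have hs' : 1 ≤ √s := Real.one_le_sqrt.2 hs1
    have := norm_sub_le (∑ j ∈ J, inner ℂ (windowUnit n H j) (B j))
      (∑ j ∈ J, inner ℂ (K.starProjection (windowUnit n H j)) (B j))
    nlinarith [Real.sqrt_nonneg ((n : ℝ) + 1)]
  refine le_trans (measureReal_mono ?_) (hζ.norm_inner_tail J
    (fun j => Kᗮ.starProjection (windowUnit n H j)) B hn1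
    (norm_sq_sum_starProjection_windowUnit_le Kᗮ J) hV hτ hβ)
  intro ω hω
  simp only [Set.mem_ofPred_eq, hBsum,
    starProjection_window_eq_sum Kᗮ (J := J) (Finset.Icc_subset_Icc (by omega) le_rfl)] at hω ⊢
  linarith

end Events

/-! ### The oracle filter -/

theorem IsPredictableSignal.exists_filter {Ω : Type*} [MeasurableSpace Ω] {μ : Measure Ω}
    [IsProbabilityMeasure μ] {ζ : ℤ → Ω → ℂ} (hζ : IsStdComplexGaussianNoise μ ζ) {σ : ℝ}
    (hσ : 0 < σ) {m n h : ℕ} {ρ : ℝ} {x : ℤ → ℂ} (hx : IsPredictableSignal μ ζ σ m n h ρ x) :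
    ∃ q ∈ seqSupportedOn (h : ℤ) (m + h),
      (∀ t : ℤ, -(m : ℤ) + h ≤ t → t ≤ n + h →
        ‖(x - convSeq q x) t‖ ^ 2 ≤ σ ^ 2 * (ρ / (m + 1))) ∧
      ∑ τ ∈ Finset.Icc (h : ℤ) (m + h), ‖q τ‖ ^ 2 ≤ ρ / (2 * (m + 1)) := by
  obtain ⟨q, hq, hint⟩ := hx
  have hbv := fun (t : ℤ) (h1 : -(m : ℤ) + h ≤ t) (h2 : t ≤ n + h) =>
    hζ.bias_variance_le hσ hq x t (R := ρ / (m + 1))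
      ((hint t h1 h2).trans (le_of_eq (by ring)))
  refine ⟨q, hq, fun t h1 h2 => (hbv t h1 h2).1, ?_⟩
  -- The variance does not depend on the time, so the single point `t = h` suffices.
  have h1 := (hbv h (by linarith [Int.natCast_nonneg m]) (by linarith [Int.natCast_nonneg n])).2
  have h2 : ρ / (2 * ((m : ℝ) + 1)) = (ρ / (m + 1)) / 2 := by field_simp
  linarith

section Oracle

variable {m n h₀ : ℕ} {ρ σ : ℝ} {q x : ℤ → ℂ}

/-- Shifted back by `2 h₀`, the oracle is the self-convolution of a filter on `[0, m]`; the constant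
closes because `n + 1 ≤ 2 (m + 1)`. -/
theorem dftNormOne_oracle_le (hn : n = 2 * m) (hρ : 0 ≤ ρ)
    (hq : q ∈ seqSupportedOn (h₀ : ℤ) (m + h₀))
    (hq2 : ∑ τ ∈ Finset.Icc (h₀ : ℤ) (m + h₀), ‖q τ‖ ^ 2 ≤ ρ / (2 * (m + 1))) :
    dftNormOne n (shiftSeq (-(2 * h₀ : ℤ)) (convSeq q q)) ≤ ρ / √((n : ℝ) + 1) := by
  have hq' : shiftSeq (-(h₀ : ℤ)) q ∈ seqSupportedOn 0 m := by
    simpa using shiftSeq_mem_seqSupportedOn (h := (h₀ : ℤ)) hq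
  rw [← convSeq_shiftSeq_shiftSeq, dftNormOne_convSeq_self hn hq']
  have h := sum_Icc_sub (fun i => ‖q (i + h₀)‖ ^ 2) h₀ (m + h₀) h₀
  simp only [sub_add_cancel, sub_self, add_sub_cancel_right] at h
  rw [h] at hq2
  simp only [shiftSeq, sub_neg_eq_add]
  rw [le_div_iff₀ (Real.sqrt_pos.2 (by positivity)), mul_right_comm,
    Real.mul_self_sqrt (by positivity)]
  have hn' : (n : ℝ) = 2 * m := by exact_mod_cast hn
  refine (mul_le_mul_of_nonneg_left hq2 (by positivity)).trans ?_
  rw [mul_div_assoc', div_le_iff₀ (by positivity), hn']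
  nlinarith [Nat.cast_nonneg (α := ℝ) m]

theorem convSeq_self_mem (hn : n = 2 * m) (hq : q ∈ seqSupportedOn (h₀ : ℤ) (m + h₀)) :
    convSeq q q ∈ seqSupportedOn (2 * h₀ : ℤ) (n + 2 * h₀) := by
  have := convSeq_mem_seqSupportedOn hq hq
  refine seqSupportedOn_mono ?_ ?_ this
  · linarith
  · rw [hn]; push_cast; linarith

theorem sum_norm_sq_le_of_dftNormOne_le {H : ℤ} {R : ℝ} {φ : ℤ → ℂ}
    (hR : dftNormOne n (shiftSeq (-H) φ) ≤ R / √((n : ℝ) + 1)) :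
    ∑ τ ∈ Finset.Icc H (n + H), ‖φ τ‖ ^ 2 ≤ R ^ 2 / (n + 1) := by
  have h := sum_Icc_sub (fun i => ‖φ (i + H)‖ ^ 2) H (n + H) H
  simp only [sub_add_cancel, sub_self, add_sub_cancel_right] at h
  have h2 := sum_norm_sq_le_dftNormOne_sq n (shiftSeq (-H) φ)
  simp only [shiftSeq, sub_neg_eq_add] at h2
  rw [h]
  refine h2.trans ((pow_le_pow_left₀ (Finset.sum_nonneg fun _ _ => norm_nonneg _) hR 2).trans ?_)
  rw [div_pow, Real.sq_sqrt (by positivity)]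

theorem norm_sq_add_le (a b : ℂ) : ‖a + b‖ ^ 2 ≤ 2 * ‖a‖ ^ 2 + 2 * ‖b‖ ^ 2 := by
  have := pow_le_pow_left₀ (norm_nonneg _) (norm_add_le a b) 2
  nlinarith [sq_nonneg (‖a‖ - ‖b‖)]

/-- The bias telescopes: with `g = x - q * x` it equals `g + q * g`. Cauchy–Schwarz bounds the
second term by `‖q‖₂²` times `m + 1` values of `|g|²`, all within the range of predictability. -/
theorem sum_norm_sq_oracle_bias_le (hn : n = 2 * m) (hρ : 1 ≤ ρ)
    (hq : q ∈ seqSupportedOn (h₀ : ℤ) (m + h₀))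
    (hq2 : ∑ τ ∈ Finset.Icc (h₀ : ℤ) (m + h₀), ‖q τ‖ ^ 2 ≤ ρ / (2 * (m + 1)))
    (hb : ∀ t : ℤ, -(m : ℤ) + h₀ ≤ t → t ≤ n + 3 * h₀ →
        ‖(x - convSeq q x) t‖ ^ 2 ≤ σ ^ 2 * (ρ / (m + 1))) :
    ‖window n (2 * h₀) (x - convSeq (convSeq q q) x)‖ ^ 2 ≤ 6 * σ ^ 2 * ρ ^ 2 := by
  have hm1 : (0 : ℝ) < m + 1 := by positivity
  have hn' : (n : ℝ) = 2 * m := by exact_mod_cast hn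
  set g := x - convSeq q x with hg
  have hdec : x - convSeq (convSeq q q) x = g + convSeq q g := by
    rw [convSeq_assoc hq hq, hg, convSeq_sub hq]
    abel
  have hpt : ∀ t ∈ Finset.Icc (2 * h₀ : ℤ) (n + 2 * h₀),
      ‖(x - convSeq (convSeq q q) x) t‖ ^ 2 ≤ 3 * σ ^ 2 * ρ ^ 2 / (m + 1) := fun t ht => by
    obtain ⟨h1, h2⟩ := Finset.mem_Icc.1 ht
    rw [hdec, Pi.add_apply]
    have e1 := hb t (by omega) (by omega)
    have e2 : ‖convSeq q g t‖ ^ 2 ≤ ρ / (2 * (m + 1)) * ((m + 1) * (σ ^ 2 * (ρ / (m + 1)))) := by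
      refine (norm_convSeq_sq_le hq g t).trans ?_
      refine mul_le_mul hq2 ?_ (Finset.sum_nonneg fun _ _ => sq_nonneg _) (by positivity)
      refine (Finset.sum_le_card_nsmul _ _ (σ ^ 2 * (ρ / (m + 1))) fun j hj => ?_).trans
        (le_of_eq ?_)
      · obtain ⟨h3, h4⟩ := Finset.mem_Icc.1 hj
        exact hb j (by omega) (by omega)
      · rw [nsmul_eq_mul, Int.card_Icc,
          show t - h₀ + 1 - (t - (m + h₀)) = ((m + 1 : ℕ) : ℤ) by push_cast; ring, Int.toNat_natCast]
        push_cast; rfl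
    refine (norm_sq_add_le _ _).trans ?_
    have e3 : ρ / (2 * (m + 1)) * ((m + 1) * (σ ^ 2 * (ρ / (m + 1))))
        = σ ^ 2 * ρ ^ 2 / (m + 1) / 2 := by field_simp
    have e4 : σ ^ 2 * (ρ / (m + 1)) ≤ σ ^ 2 * ρ ^ 2 / (m + 1) := by
      rw [mul_div_assoc]
      gcongr
      nlinarith
    have e5 : 3 * σ ^ 2 * ρ ^ 2 / ((m : ℝ) + 1) = 3 * (σ ^ 2 * ρ ^ 2 / (m + 1)) := by ring
    linarith
  rw [norm_window_sq]
  refine (Finset.sum_le_card_nsmul _ _ _ hpt).trans ?_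
  rw [nsmul_eq_mul, Int.card_Icc,
    show (n : ℤ) + 2 * h₀ + 1 - 2 * h₀ = ((n + 1 : ℕ) : ℤ) by push_cast; ring, Int.toNat_natCast]
  push_cast
  rw [mul_div_assoc', div_le_iff₀ hm1, hn']
  have : 0 ≤ σ ^ 2 * ρ ^ 2 := by positivity
  nlinarith

end Oracle

/-! ### The basic inequality of the least-squares estimator -/

theorem norm_sq_le_of_norm_add_le {W : Type*} [NormedAddCommGroup W] [InnerProductSpace ℂ W]
    (K : Submodule ℂ W) [K.HasOrthogonalProjection] {v v₀ w : W} {σ A B : ℝ} (hσ : 0 ≤ σ)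
    (h : ‖v + (σ : ℂ) • w‖ ^ 2 ≤ ‖v₀ + (σ : ℂ) • w‖ ^ 2) (hA : ‖K.starProjection w‖ ^ 2 ≤ A)
    (hB : ‖inner ℂ (Kᗮ.starProjection w) (v₀ - v)‖ ≤ σ * B) :
    ‖v‖ ^ 2 ≤ 4 * ‖v₀‖ ^ 2 + 6 * σ ^ 2 * A + 4 * σ ^ 2 * B := by
  have hexp : ∀ u : W, ‖u + (σ : ℂ) • w‖ ^ 2
      = ‖u‖ ^ 2 + 2 * (σ * (inner ℂ w u).re) + ‖(σ : ℂ) • w‖ ^ 2 := fun u => by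
    rw [norm_add_sq (𝕜 := ℂ), inner_smul_right, ← inner_conj_symm u w, RCLike.re_to_complex,
      Complex.re_ofReal_mul, Complex.conj_re]
  rw [hexp, hexp] at h
  have h1 : (inner ℂ w (v₀ - v)).re = (inner ℂ w v₀).re - (inner ℂ w v).re := by
    rw [inner_sub_right, Complex.sub_re]
  have h2 : (inner ℂ w (v₀ - v)).re ≤ ‖K.starProjection w‖ * (‖v₀‖ + ‖v‖) + σ * B := by
    have h3 : inner ℂ w (v₀ - v) = inner ℂ (K.starProjection w) (v₀ - v)
        + inner ℂ (Kᗮ.starProjection w) (v₀ - v) := by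
      rw [← inner_add_left, Submodule.starProjection_add_starProjection_orthogonal]
    rw [h3, Complex.add_re]
    refine add_le_add ?_ ((Complex.re_le_norm _).trans hB)
    refine (Complex.re_le_norm _).trans ((norm_inner_le_norm _ _).trans ?_)
    gcongr
    exact norm_sub_le _ _
  have h4 : ‖v‖ ^ 2 ≤ ‖v₀‖ ^ 2 + 2 * (σ * (‖K.starProjection w‖ * (‖v₀‖ + ‖v‖) + σ * B)) := by
    have := mul_le_mul_of_nonneg_left h2 hσ
    rw [h1] at this
    linarith
  have h5 : σ ^ 2 * ‖K.starProjection w‖ ^ 2 ≤ σ ^ 2 * A := by gcongr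
  -- The first square absorbs the term linear in `‖v‖` into half of `‖v‖²`, the second does the same
  -- for `‖v₀‖`.
  nlinarith [sq_nonneg (‖v‖ - 2 * (σ * ‖K.starProjection w‖)),
    sq_nonneg (‖v₀‖ - σ * ‖K.starProjection w‖), sq_nonneg ‖v₀‖]

theorem window_convSeq {n : ℕ} {H : ℤ} {δ : ℤ → ℂ} (hδ : δ ∈ seqSupportedOn H (n + H))
    (v : ℤ → ℂ) : window n H (convSeq δ v) = ∑ k ∈ Finset.range (n + 1),
      dftCoeff n (shiftSeq (-H) δ) k • window n 0 (convSeq (harmonicFilter n k) v) := by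
  ext i
  rw [WithLp.ofLp_sum, Finset.sum_apply, window_apply, convSeq_eq_sum_dftCoeff hδ]
  refine Finset.sum_congr rfl fun k _ => ?_
  rw [PiLp.smul_apply, window_apply, smul_eq_mul, add_sub_cancel_right, add_zero]

/-- Hölder's inequality in the Fourier domain. It makes the bound uniform over all filters of given
ℓ₁ norm, hence valid for one chosen from the data. -/
theorem norm_inner_window_convSeq_le {n : ℕ} {H : ℤ} {δ : ℤ → ℂ}
    (hδ : δ ∈ seqSupportedOn H (n + H)) (v : ℤ → ℂ) (w : EuclideanSpace ℂ (Fin (n + 1))) {R : ℝ}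
    (hR : ∀ k ∈ Finset.range (n + 1),
      ‖inner ℂ w (window n 0 (convSeq (harmonicFilter n k) v))‖ ≤ R) :
    ‖inner ℂ w (window n H (convSeq δ v))‖ ≤ dftNormOne n (shiftSeq (-H) δ) * R := by
  rw [window_convSeq hδ, inner_sum, dftNormOne, Finset.sum_mul]
  refine norm_sum_le_of_le _ fun k hk => ?_
  rw [inner_smul_right, norm_mul]
  exact mul_le_mul_of_nonneg_left (hR k hk) (norm_nonneg _)

/-- A filter supported on nonnegative times combines only iterates of the forward shift, so
one-sided invariance is enough. -/
theorem convSeq_mem_of_shift_mem {S : Submodule ℂ (ℤ → ℂ)} (hS : ∀ u ∈ S, shiftSeq 1 u ∈ S)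
    {a b : ℤ} (ha : 0 ≤ a) {δ : ℤ → ℂ} (hδ : δ ∈ seqSupportedOn a b) {u : ℤ → ℂ} (hu : u ∈ S) :
    convSeq δ u ∈ S := by
  have hshift : ∀ k : ℕ, shiftSeq k u ∈ S := fun k => by
    induction k with
    | zero => convert hu using 1; funext t; simp [shiftSeq]
    | succ k ih =>
      convert hS _ ih using 1
      funext t
      simp only [shiftSeq]
      congr 1
      push_cast
      ring
  have : convSeq δ u = ∑ τ ∈ Finset.Icc a b, δ τ • shiftSeq τ u := by
    funext t
    rw [convSeq_eq_sum hδ subset_rfl, Finset.sum_apply]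
    rfl
  rw [this]
  refine S.sum_mem fun τ hτ => S.smul_mem _ ?_
  obtain ⟨k, rfl⟩ := Int.eq_ofNat_of_zero_le (ha.trans (Finset.mem_Icc.1 hτ).1)
  exact hshift k

/-! ### Deterministic analysis on the good event -/

/-- The noise realizations for which the error bounds hold. Here `q` is the oracle filter, `K` the
space of windows of the shift-invariant subspace and `ε` the deviation of the signal from it. -/
structure IsGoodNoise (m n h₀ : ℕ) (ρ η s l l' : ℝ)
    (K : Submodule ℂ (EuclideanSpace ℂ (Fin (n + 1)))) (q ε z : ℤ → ℂ) : Prop where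
  oracle : ∑ t ∈ Finset.Icc (2 * h₀ : ℤ) (n + 2 * h₀), ‖convSeq (convSeq q q) z t‖ ^ 2
    ≤ 4 * ρ ^ 2 * (1 + l)
  proj : ‖K.starProjection (window n (2 * h₀) z)‖ ^ 2 ≤ 4 * (s + l)
  approx : ∑ k ∈ Finset.range (n + 1), ‖inner ℂ (Kᗮ.starProjection (window n (2 * h₀) z))
    (window n 0 (convSeq (harmonicFilter n k) ε))‖ ^ 2 ≤ 4 * ((n + 1) * η ^ 2) * (1 + l)
  filtered : ∀ k ∈ Finset.range (n + 1), ‖inner ℂ (Kᗮ.starProjection (window n (2 * h₀) z))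
    (window n 0 (convSeq (harmonicFilter n k) z))‖ ≤ 8 * √((n : ℝ) + 1) * (√s + (1 + l'))
  harmonic : ∀ k ∈ Finset.range (n + 1), ∀ t ∈ Finset.Icc (m + h₀ : ℤ) (n + h₀),
    ‖convSeq (harmonicFilter n k) z t‖ ^ 2 ≤ 4 * (1 + l')
  smoothed : ∑ t ∈ Finset.Icc (-m + h₀ : ℤ) (n + h₀), ‖convSeq q z t‖ ^ 2 ≤ 8 * ρ * (1 + l)

section Deterministic

variable {m n h₀ : ℕ} {ρ σ ϰ s l l' : ℝ} {q x ε z φ : ℤ → ℂ}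
  {K : Submodule ℂ (EuclideanSpace ℂ (Fin (n + 1)))}

theorem norm_sq_window_oracle_error_le (hn : n = 2 * m) (hρ : 1 ≤ ρ) (hl : 0 ≤ l)
    (hq : q ∈ seqSupportedOn (h₀ : ℤ) (m + h₀))
    (hq2 : ∑ τ ∈ Finset.Icc (h₀ : ℤ) (m + h₀), ‖q τ‖ ^ 2 ≤ ρ / (2 * (m + 1)))
    (hb : ∀ t : ℤ, -(m : ℤ) + h₀ ≤ t → t ≤ n + 3 * h₀ →
        ‖(x - convSeq q x) t‖ ^ 2 ≤ σ ^ 2 * (ρ / (m + 1)))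
    (hz : IsGoodNoise m n h₀ ρ (ϰ * σ) s l l' K q ε z) :
    ‖window n (2 * h₀) (x - convSeq (convSeq q q) (observedSeq x σ z))‖ ^ 2
      ≤ 20 * σ ^ 2 * (ρ ^ 2 * (1 + l)) := by
  have hmem := convSeq_self_mem hn hq
  have h1 : x - convSeq (convSeq q q) (observedSeq x σ z)
      = (x - convSeq (convSeq q q) x) - (σ : ℂ) • convSeq (convSeq q q) z := by
    rw [observedSeq_eq, convSeq_add hmem, convSeq_smul hmem]
    abel
  have h2 := sum_norm_sq_oracle_bias_le hn hρ hq hq2 hb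
  have h3 : ‖window n (2 * h₀) (convSeq (convSeq q q) z)‖ ^ 2 ≤ 4 * ρ ^ 2 * (1 + l) := by
    rw [norm_window_sq]
    exact hz.oracle
  rw [h1, map_sub, map_smul]
  set a := window n (2 * h₀) (x - convSeq (convSeq q q) x)
  set b := window n (2 * h₀) (convSeq (convSeq q q) z)
  have h4 : ‖(σ : ℂ) • b‖ ^ 2 ≤ σ ^ 2 * (4 * ρ ^ 2 * (1 + l)) := by
    rw [norm_smul, mul_pow, Complex.norm_real, Real.norm_eq_abs, sq_abs]
    gcongr
  have h5 := pow_le_pow_left₀ (norm_nonneg _) (norm_sub_le a ((σ : ℂ) • b)) 2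
  have h6 : 0 ≤ σ ^ 2 * ρ ^ 2 * l := by positivity
  nlinarith [sq_nonneg (‖a‖ - ‖(σ : ℂ) • b‖)]

/-- Of the three parts of `δ * y`, the one from `xS` lies in `K` and drops out. The other two are
bounded by Hölder, the factors `√(n + 1)` cancelling. -/
theorem norm_inner_window_difference_le (hρ : 1 ≤ ρ) (hl : 0 ≤ l) (hl' : 0 ≤ l') (hσ : 0 < σ)
    (hϰ : 0 ≤ ϰ) {xS δ : ℤ → ℂ} (hx : x = xS + ε)
    (hδ : δ ∈ seqSupportedOn (2 * h₀ : ℤ) (n + 2 * h₀))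
    (hδ1 : dftNormOne n (shiftSeq (-(2 * h₀ : ℤ)) δ) ≤ 4 * ρ / √((n : ℝ) + 1))
    (hK : window n (2 * h₀) (convSeq δ xS) ∈ K)
    (hz : IsGoodNoise m n h₀ ρ (ϰ * σ) s l l' K q ε z) :
    ‖inner ℂ (Kᗮ.starProjection (window n (2 * h₀) z))
      (window n (2 * h₀) (convSeq δ (observedSeq x σ z)))‖
      ≤ σ * (8 * ρ * ϰ * √(1 + l) + 32 * ρ * (√s + (1 + l'))) := by
  have hN : 0 < √((n : ℝ) + 1) := Real.sqrt_pos.2 (by positivity)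
  set w := Kᗮ.starProjection (window n (2 * h₀) z) with hw
  have hwK : inner ℂ w (window n (2 * h₀) (convSeq δ xS)) = 0 := by
    have : w ∈ Kᗮ := Submodule.starProjection_apply_mem _ _
    exact Submodule.inner_left_of_mem_orthogonal hK this
  have h1 : convSeq δ (observedSeq x σ z)
      = convSeq δ xS + convSeq δ ε + (σ : ℂ) • convSeq δ z := by
    rw [observedSeq_eq, hx, convSeq_add hδ, convSeq_add hδ, convSeq_smul hδ]
  rw [h1, map_add, map_add, map_smul, inner_add_right, inner_add_right, hwK, zero_add,
    inner_smul_right]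
  have h2 : ‖inner ℂ w (window n (2 * h₀) (convSeq δ ε))‖
      ≤ 4 * ρ / √((n : ℝ) + 1) * (2 * √((n : ℝ) + 1) * (ϰ * σ) * √(1 + l)) := by
    refine (norm_inner_window_convSeq_le hδ ε w
      (R := 2 * √((n : ℝ) + 1) * (ϰ * σ) * √(1 + l)) fun k hk => ?_).trans ?_
    · refine le_of_sq_le_sq ?_ (by positivity)
      -- The maximum over frequencies is bounded by the whole ℓ₂ sum.
      refine (Finset.single_le_sum (fun k _ => sq_nonneg (‖inner ℂ w
        (window n 0 (convSeq (harmonicFilter n k) ε))‖)) hk).trans (hz.approx.trans (le_of_eq ?_))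
      rw [mul_pow (2 * √((n : ℝ) + 1) * (ϰ * σ)), mul_pow (2 * √((n : ℝ) + 1)), mul_pow 2,
        Real.sq_sqrt (by positivity), Real.sq_sqrt (by positivity)]
      ring
    · gcongr
  have h3 : ‖inner ℂ w (window n (2 * h₀) (convSeq δ z))‖
      ≤ 4 * ρ / √((n : ℝ) + 1) * (8 * √((n : ℝ) + 1) * (√s + (1 + l'))) := by
    refine (norm_inner_window_convSeq_le hδ z w hz.filtered).trans ?_
    gcongr
  refine (norm_add_le _ _).trans ?_
  rw [norm_mul, Complex.norm_real, Real.norm_eq_abs, abs_of_pos hσ]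
  have e2 : 4 * ρ / √((n : ℝ) + 1) * (2 * √((n : ℝ) + 1) * (ϰ * σ) * √(1 + l))
      = σ * (8 * ρ * ϰ * √(1 + l)) := by field_simp; ring
  have e3 : 4 * ρ / √((n : ℝ) + 1) * (8 * √((n : ℝ) + 1) * (√s + (1 + l')))
      = 32 * ρ * (√s + (1 + l')) := by field_simp; ring
  rw [e2] at h2
  rw [e3] at h3
  have := mul_le_mul_of_nonneg_left h3 hσ.le
  linarith

theorem norm_sq_window_error_le (hn : n = 2 * m) (hρ : 1 ≤ ρ) (hl : 0 ≤ l) (hl' : 0 ≤ l')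
    (hσ : 0 < σ) (hϰ : 0 ≤ ϰ)
    (hq : q ∈ seqSupportedOn (h₀ : ℤ) (m + h₀))
    (hq2 : ∑ τ ∈ Finset.Icc (h₀ : ℤ) (m + h₀), ‖q τ‖ ^ 2 ≤ ρ / (2 * (m + 1)))
    (hb : ∀ t : ℤ, -(m : ℤ) + h₀ ≤ t → t ≤ n + 3 * h₀ →
        ‖(x - convSeq q x) t‖ ^ 2 ≤ σ ^ 2 * (ρ / (m + 1)))
    {S : Submodule ℂ (ℤ → ℂ)} (hS : ∀ u ∈ S, shiftSeq 1 u ∈ S) {xS : ℤ → ℂ} (hxS : xS ∈ S)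
    (hx : x = xS + ε)
    (hz : IsGoodNoise m n h₀ ρ (ϰ * σ) s l l' (S.map (window n (2 * h₀))) q ε z)
    (hφ : IsPredictLSE n (2 * h₀) (2 * ρ) (observedSeq x σ z) φ) :
    ‖window n (2 * h₀) (x - convSeq φ (observedSeq x σ z))‖ ^ 2 ≤
      80 * σ ^ 2 * (ρ ^ 2 * (1 + l)) + 24 * σ ^ 2 * (s + l)
        + 4 * σ ^ 2 * (8 * ρ * ϰ * √(1 + l) + 32 * ρ * (√s + (1 + l'))) := by
  set y := observedSeq x σ z with hy
  obtain ⟨⟨hφs, hφ1⟩, hmin⟩ := hφ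
  push_cast at hφs hφ1 hmin
  have hos := convSeq_self_mem hn hq
  have ho1 := dftNormOne_oracle_le hn (by linarith) hq hq2
  have hN : 0 < √((n : ℝ) + 1) := Real.sqrt_pos.2 (by positivity)
  have hfeas : convSeq q q ∈ predictFeasible n (2 * h₀) (2 * ρ) := by
    refine ⟨by push_cast; exact hos, ?_⟩
    push_cast
    refine ho1.trans ?_
    gcongr
    linarith
  have hle := hmin hfeas
  simp only [Set.mem_ofPred_eq, windowNorm_shiftSeq] at hle
  have hnoise : ∀ ψ : ℤ → ℂ, window n (2 * h₀) (y - convSeq ψ y)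
      = window n (2 * h₀) (x - convSeq ψ y) + (σ : ℂ) • window n (2 * h₀) z := fun ψ => by
    rw [← map_smul, ← map_add]
    congr 1
    rw [hy, observedSeq_eq]
    abel
  rw [hnoise, hnoise] at hle
  have hδs : φ - convSeq q q ∈ seqSupportedOn (2 * h₀ : ℤ) (n + 2 * h₀) := fun t ht => by
    rw [Pi.sub_apply, hφs t ht, hos t ht, sub_zero]
  -- At most `2 ρ` from the constraint on `φ` plus `ρ` from the oracle, rounded up to `4 ρ`.
  have hδ1 : dftNormOne n (shiftSeq (-(2 * h₀ : ℤ)) (φ - convSeq q q))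
      ≤ 4 * ρ / √((n : ℝ) + 1) := by
    refine (dftNormOne_sub_le n (shiftSeq (-(2 * h₀ : ℤ)) φ)
      (shiftSeq (-(2 * h₀ : ℤ)) (convSeq q q))).trans ((add_le_add hφ1 ho1).trans ?_)
    rw [← add_div]
    gcongr
    linarith
  have hdiff : window n (2 * h₀) (x - convSeq (convSeq q q) y)
      - window n (2 * h₀) (x - convSeq φ y) = window n (2 * h₀) (convSeq (φ - convSeq q q) y) := by
    rw [← map_sub, sub_convSeq hφs hos]
    congr 1
    abel
  have hB := norm_inner_window_difference_le hρ hl hl' hσ hϰ hx hδs hδ1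
    (Submodule.mem_map_of_mem (convSeq_mem_of_shift_mem hS (by positivity) hδs hxS)) hz
  rw [← hy, ← hdiff] at hB
  have h1 := norm_sq_le_of_norm_add_le _ hσ.le hle hz.proj hB
  have h2 := norm_sq_window_oracle_error_le hn hρ hl hq hq2 hb hz
  linarith

theorem norm_sq_add_five_le (a b c d e : ℂ) :
    ‖a + b + c + d + e‖ ^ 2
      ≤ 5 * (‖a‖ ^ 2 + ‖b‖ ^ 2 + ‖c‖ ^ 2 + ‖d‖ ^ 2 + ‖e‖ ^ 2) := by
  have h : ‖a + b + c + d + e‖ ≤ ‖a‖ + ‖b‖ + ‖c‖ + ‖d‖ + ‖e‖ := by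
    linarith [norm_add_le (a + b + c + d) e, norm_add_le (a + b + c) d, norm_add_le (a + b) c,
      norm_add_le a b]
  refine (pow_le_pow_left₀ (norm_nonneg _) h 2).trans ?_
  nlinarith [sq_nonneg (‖a‖ - ‖b‖), sq_nonneg (‖a‖ - ‖c‖), sq_nonneg (‖a‖ - ‖d‖),
    sq_nonneg (‖a‖ - ‖e‖), sq_nonneg (‖b‖ - ‖c‖), sq_nonneg (‖b‖ - ‖d‖), sq_nonneg (‖b‖ - ‖e‖),
    sq_nonneg (‖c‖ - ‖d‖), sq_nonneg (‖c‖ - ‖e‖), sq_nonneg (‖d‖ - ‖e‖)]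

/-- Convolution with `q` averages earlier errors, so the window bound transfers to a point ahead of
the window. What remains of the error after applying `1 - q` is estimated term by term, using `‖φ‖₂²
≤ 4 ρ² / (n + 1)`. -/
theorem norm_sq_error_apply_le (hn : n = 2 * m) (hρ : 1 ≤ ρ) (hl : 0 ≤ l) (hl' : 0 ≤ l')
    (hq : q ∈ seqSupportedOn (h₀ : ℤ) (m + h₀))
    (hq2 : ∑ τ ∈ Finset.Icc (h₀ : ℤ) (m + h₀), ‖q τ‖ ^ 2 ≤ ρ / (2 * (m + 1)))
    (hb : ∀ t : ℤ, -(m : ℤ) + h₀ ≤ t → t ≤ n + 3 * h₀ →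
        ‖(x - convSeq q x) t‖ ^ 2 ≤ σ ^ 2 * (ρ / (m + 1)))
    (hz : IsGoodNoise m n h₀ ρ (ϰ * σ) s l l' K q ε z)
    (hφs : φ ∈ seqSupportedOn (2 * h₀ : ℤ) (n + 2 * h₀))
    (hφ1 : dftNormOne n (shiftSeq (-(2 * h₀ : ℤ)) φ) ≤ 2 * ρ / √((n : ℝ) + 1))
    {r : ℝ} (hr : ‖window n (2 * h₀) (x - convSeq φ (observedSeq x σ z))‖ ^ 2 ≤ r)
    {t : ℤ} (ht1 : (m : ℤ) + 3 * h₀ ≤ t) (ht2 : t ≤ n + 3 * h₀) :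
    ‖(x - convSeq φ (observedSeq x σ z)) t‖ ^ 2 ≤ 5 * (ρ / (n + 1) *
      (r + 2 * σ ^ 2 + 8 * σ ^ 2 * ρ ^ 2 + 16 * σ ^ 2 * (ρ * (1 + l'))
        + 32 * σ ^ 2 * (ρ ^ 2 * (1 + l)))) := by
  have hn' : (n : ℝ) = 2 * m := by exact_mod_cast hn
  have hn1 : (0 : ℝ) < (n : ℝ) + 1 := by positivity
  have hm1 : (0 : ℝ) < (m : ℝ) + 1 := by positivity
  have hρ0 : 0 ≤ ρ := by linarith
  have hr0 : 0 ≤ r := (sq_nonneg _).trans hr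
  set y := observedSeq x σ z with hy
  set e := x - convSeq φ y with he
  set g := x - convSeq q x with hg
  have hdec : e = convSeq q e + g + (-convSeq φ g) + (-((σ : ℂ) • convSeq φ z))
      + (σ : ℂ) • convSeq φ (convSeq q z) := by
    have h1 : convSeq q e = convSeq q x - convSeq φ (convSeq q y) := by
      rw [he, convSeq_sub hq, convSeq_left_comm hq hφs]
    have h2 : convSeq q y = convSeq q x + (σ : ℂ) • convSeq q z := by
      rw [hy, observedSeq_eq, convSeq_add hq, convSeq_smul hq]
    have h3 : convSeq φ y = convSeq φ x + (σ : ℂ) • convSeq φ z := by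
      rw [hy, observedSeq_eq, convSeq_add hφs, convSeq_smul hφs]
    rw [h1, h2, hg, convSeq_add hφs, convSeq_smul hφs, convSeq_sub hφs, he, h3]
    abel
  have hφ2 := sum_norm_sq_le_of_dftNormOne_le hφ1
  have a1 : ‖convSeq q e t‖ ^ 2 ≤ ρ / (n + 1) * r := by
    refine (norm_convSeq_sq_le hq e t).trans ?_
    -- The range of `t` is dictated here: `[t - m - h₀, t - h₀]` lies in `[2 h₀, n + 2 h₀]` exactly
    -- when `m + 3 h₀ ≤ t ≤ n + 3 h₀`.
    have hsum : ∑ j ∈ Finset.Icc (t - (m + h₀)) (t - h₀), ‖e j‖ ^ 2 ≤ r := by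
      rw [norm_window_sq] at hr
      refine (Finset.sum_le_sum_of_subset_of_nonneg
        (Finset.Icc_subset_Icc (by omega) (by omega)) fun _ _ _ => sq_nonneg _).trans hr
    refine mul_le_mul (hq2.trans ?_) hsum (Finset.sum_nonneg fun _ _ => sq_nonneg _)
      (by positivity)
    gcongr
    linarith
  have hmn : ρ / ((m : ℝ) + 1) ≤ 2 * (ρ / (n + 1)) := by
    rw [mul_div_assoc', div_le_div_iff₀ hm1 hn1, hn']
    nlinarith
  have a2 : ‖g t‖ ^ 2 ≤ ρ / (n + 1) * (2 * σ ^ 2) := by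
    refine (hb t (by omega) (by omega)).trans ?_
    have := mul_le_mul_of_nonneg_left hmn (sq_nonneg σ)
    linarith
  have a3 : ‖(-convSeq φ g) t‖ ^ 2 ≤ ρ / (n + 1) * (8 * σ ^ 2 * ρ ^ 2) := by
    rw [Pi.neg_apply, norm_neg]
    refine (norm_convSeq_sq_le hφs g t).trans ?_
    have hsum : ∑ j ∈ Finset.Icc (t - (n + 2 * h₀)) (t - 2 * h₀), ‖g j‖ ^ 2
        ≤ (n + 1) * (σ ^ 2 * (2 * (ρ / (n + 1)))) := by
      refine (Finset.sum_le_card_nsmul _ _ (σ ^ 2 * (2 * (ρ / (n + 1)))) fun j hj => ?_).trans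
        (le_of_eq ?_)
      · obtain ⟨h3, h4⟩ := Finset.mem_Icc.1 hj
        refine (hb j (by omega) (by omega)).trans ?_
        gcongr
      · rw [nsmul_eq_mul, Int.card_Icc,
          show t - 2 * h₀ + 1 - (t - (n + 2 * h₀)) = ((n + 1 : ℕ) : ℤ) by push_cast; ring,
          Int.toNat_natCast]
        push_cast; rfl
    refine (mul_le_mul hφ2 hsum (Finset.sum_nonneg fun _ _ => sq_nonneg _)
      (by positivity)).trans (le_of_eq ?_)
    field_simp
    ring
  have a4 : ‖(-((σ : ℂ) • convSeq φ z)) t‖ ^ 2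
      ≤ ρ / (n + 1) * (16 * σ ^ 2 * (ρ * (1 + l'))) := by
    -- Cauchy–Schwarz would lose a factor of order `n`; Hölder over the harmonic filters costs only
    -- a logarithm.
    have h1 : ‖convSeq φ z t‖ ≤ 2 * ρ / √((n : ℝ) + 1) * √(4 * (1 + l')) := by
      rw [convSeq_eq_sum_dftCoeff hφs]
      refine (norm_sum_le _ _).trans ?_
      refine le_trans ?_ (mul_le_mul_of_nonneg_right hφ1 (Real.sqrt_nonneg _))
      rw [dftNormOne, Finset.sum_mul]
      refine Finset.sum_le_sum fun k hk => ?_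
      rw [norm_mul]
      refine mul_le_mul_of_nonneg_left ?_ (norm_nonneg _)
      exact Real.le_sqrt_of_sq_le (hz.harmonic k hk _ (Finset.mem_Icc.2 ⟨by omega, by omega⟩))
    rw [Pi.neg_apply, norm_neg, Pi.smul_apply, smul_eq_mul, norm_mul, mul_pow, Complex.norm_real,
      Real.norm_eq_abs, sq_abs]
    refine (mul_le_mul_of_nonneg_left (pow_le_pow_left₀ (norm_nonneg _) h1 2)
      (sq_nonneg σ)).trans (le_of_eq ?_)
    rw [mul_pow, div_pow, Real.sq_sqrt hn1.le, Real.sq_sqrt (by positivity)]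
    field_simp
    ring
  have a5 : ‖((σ : ℂ) • convSeq φ (convSeq q z)) t‖ ^ 2
      ≤ ρ / (n + 1) * (32 * σ ^ 2 * (ρ ^ 2 * (1 + l))) := by
    rw [Pi.smul_apply, smul_eq_mul, norm_mul, mul_pow, Complex.norm_real,
      Real.norm_eq_abs, sq_abs]
    have hsum : ∑ j ∈ Finset.Icc (t - (n + 2 * h₀)) (t - 2 * h₀), ‖convSeq q z j‖ ^ 2
        ≤ 8 * ρ * (1 + l) :=
      (Finset.sum_le_sum_of_subset_of_nonneg
        (Finset.Icc_subset_Icc (by omega) (by omega)) fun _ _ _ => sq_nonneg _).trans hz.smoothed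
    refine (mul_le_mul_of_nonneg_left ((norm_convSeq_sq_le hφs (convSeq q z) t).trans
      (mul_le_mul hφ2 hsum (Finset.sum_nonneg fun _ _ => sq_nonneg _)
      (by positivity))) (sq_nonneg σ)).trans (le_of_eq ?_)
    field_simp
    ring
  rw [hdec]
  simp only [Pi.add_apply]
  refine (norm_sq_add_five_le _ _ _ _ _).trans ?_
  linarith

end Deterministic

/-! ### The error bounds hold with high probability -/

theorem IsStdComplexGaussianNoise.exists_isNoiseEvent_isGoodNoise {Ω : Type*} [MeasurableSpace Ω]
    {μ : Measure Ω} [IsProbabilityMeasure μ] {ζ : ℤ → Ω → ℂ} (hζ : IsStdComplexGaussianNoise μ ζ)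
    {m n h₀ : ℕ} (hn : n = 2 * m) {ρ η s α : ℝ} (hρ : 1 ≤ ρ) (hs1 : 1 ≤ s)
    (K : Submodule ℂ (EuclideanSpace ℂ (Fin (n + 1)))) (hs : (Module.finrank ℂ K : ℝ) ≤ s)
    {q ε : ℤ → ℂ} (hq : q ∈ seqSupportedOn (h₀ : ℤ) (m + h₀))
    (hq2 : ∑ τ ∈ Finset.Icc (h₀ : ℤ) (m + h₀), ‖q τ‖ ^ 2 ≤ ρ / (2 * (m + 1)))
    (hε : ∑ k ∈ Finset.range (n + 1), ‖window n 0 (convSeq (harmonicFilter n k) ε)‖ ^ 2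
      ≤ (n + 1) * η ^ 2) (hα : 0 < α) :
    ∃ Ξ : Set (ℤ → ℂ), IsNoiseEvent μ ζ α Ξ ∧ ∀ z ∈ Ξ,
      IsGoodNoise m n h₀ ρ η s (Real.log (1 / (α / 8)))
        (Real.log (1 / (α / (16 * ((n : ℝ) + 1) ^ 2)))) K q ε z := by
  have hn' : (n : ℝ) = 2 * m := by exact_mod_cast hn
  have hn1 : (0 : ℝ) < (n : ℝ) + 1 := by positivity
  have hm0 : (0 : ℝ) ≤ m := Nat.cast_nonneg m
  have hβ : 0 < α / 8 := by positivity
  -- Four events get `α / 8` each. The two families of `n + 1` and `(n + 1) (m + 1)` events, at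
  -- levels `4 β` and `β`, cost at most `α / 4` each.
  set β := α / (16 * ((n : ℝ) + 1) ^ 2) with hβdef
  have hβ' : 0 < β := by positivity
  have e1 := hζ.isNoiseEvent_convSeq (convSeq_self_mem hn hq) (2 * h₀ : ℤ) (n + 2 * h₀)
    (V := ρ ^ 2) (by
      rw [Int.card_Icc, show (n : ℤ) + 2 * h₀ + 1 - 2 * h₀ = ((n + 1 : ℕ) : ℤ) by push_cast; ring,
        Int.toNat_natCast]
      push_cast
      refine (mul_le_mul_of_nonneg_left (sum_norm_sq_le_of_dftNormOne_le
        (dftNormOne_oracle_le hn (by linarith) hq hq2)) hn1.le).trans (le_of_eq ?_)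
      field_simp) hβ
  have e2 := hζ.isNoiseEvent_starProjection K (2 * h₀) hβ
  have e3 := hζ.isNoiseEvent_sum_inner Kᗮ (2 * h₀) (n + 1)
    (fun k => window n 0 (convSeq (harmonicFilter n k) ε)) hβ hε
  have e4 := hζ.isNoiseEvent_biInter (Finset.range (n + 1)) fun k _ =>
    hζ.isNoiseEvent_inner_convSeq K (H := 2 * h₀) (by positivity) k hs1 hs hβ'
  have e5 := hζ.isNoiseEvent_biInter (Finset.range (n + 1) ×ˢ Finset.Icc (m + h₀ : ℤ) (n + h₀))
    fun p _ => hζ.isNoiseEvent_convSeq (harmonicFilter_mem n p.1) p.2 p.2 (V := 1) (by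
      simpa using sum_norm_sq_harmonicFilter_le n p.1 _) hβ'
  have e6 := hζ.isNoiseEvent_convSeq hq (-m + h₀ : ℤ) (n + h₀) (V := 2 * ρ) (by
      rw [Int.card_Icc, show (n : ℤ) + h₀ + 1 - (-m + h₀) = ((n + m + 1 : ℕ) : ℤ) by push_cast; ring,
        Int.toNat_natCast]
      push_cast
      refine (mul_le_mul_of_nonneg_left hq2 (by positivity)).trans ?_
      rw [mul_div_assoc', div_le_iff₀ (by positivity), hn']
      nlinarith) hβ
  refine ⟨_, (hζ.isNoiseEvent_inter (hζ.isNoiseEvent_inter (hζ.isNoiseEvent_inter e1 e2)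
    (hζ.isNoiseEvent_inter e3 e6)) (hζ.isNoiseEvent_inter e4 e5)).mono ?_, ?_⟩
  · rw [Finset.card_product, Finset.card_range, Int.card_Icc,
      show (n : ℤ) + h₀ + 1 - (m + h₀) = ((m + 1 : ℕ) : ℤ) by rw [hn]; push_cast; ring,
      Int.toNat_natCast]
    push_cast
    have h1 : ((n : ℝ) + 1) * (4 * β) ≤ α / 4 := by
      rw [hβdef, mul_div_assoc', mul_div_assoc', div_le_div_iff₀ (by positivity) (by positivity)]
      nlinarith [mul_nonneg hα.le hn1.le, mul_nonneg (mul_nonneg hα.le hn1.le) (Nat.cast_nonneg (α := ℝ) n)]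
    have h2 : ((n : ℝ) + 1) * ((m : ℝ) + 1) * β ≤ α / 4 := by
      have : ((n : ℝ) + 1) * ((m : ℝ) + 1) * β ≤ ((n : ℝ) + 1) * ((n : ℝ) + 1) * β := by
        gcongr
        linarith
      refine this.trans (le_of_eq_of_le (b := α / 16) ?_ (by linarith))
      rw [hβdef]
      field_simp
    linarith
  · rintro z ⟨⟨⟨h1, h2⟩, h3, h6⟩, h4, h5⟩
    simp only [Set.mem_iInter, Set.mem_ofPred_eq] at h1 h2 h3 h4 h5 h6
    refine ⟨h1, h2.trans (by gcongr), h3, h4, fun k hk t ht => ?_, ?_⟩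
    · have := h5 (k, t) (Finset.mem_product.2 ⟨hk, ht⟩)
      simpa using this
    · refine h6.trans (le_of_eq (by ring))

/-- Parseval at each time replaces the sum over frequencies by a sum over lags, that is, over the `n
+ 1` windows `[-τ, n - τ]`. -/
theorem sum_norm_sq_window_harmonicFilter_le {n : ℕ} {ε : ℤ → ℂ} {η : ℝ}
    (hε : ∀ τ : ℤ, 0 ≤ τ → τ ≤ n → windowNorm n (shiftSeq τ ε) ≤ η) :
    ∑ k ∈ Finset.range (n + 1), ‖window n 0 (convSeq (harmonicFilter n k) ε)‖ ^ 2
      ≤ (n + 1) * η ^ 2 := by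
  have h1 : ∀ k, ‖window n 0 (convSeq (harmonicFilter n k) ε)‖ ^ 2
      = ∑ t ∈ Finset.range (n + 1), ‖convSeq (harmonicFilter n k) ε t‖ ^ 2 := fun k => by
    rw [norm_window_sq, add_zero, sum_range_eq_sum_Icc
      (fun t => ‖convSeq (harmonicFilter n k) ε t‖ ^ 2)]
  simp only [h1]
  rw [Finset.sum_comm]
  simp only [sum_norm_sq_convSeq_harmonicFilter]
  rw [Finset.sum_comm]
  refine (Finset.sum_le_card_nsmul _ _ (η ^ 2) fun τ hτ => ?_).trans (le_of_eq ?_)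
  · have h2 := hε τ (by positivity) (by rw [Finset.mem_range] at hτ; omega)
    rw [windowNorm] at h2
    have h3 : (0 : ℝ) ≤ ∑ t ∈ Finset.range (n + 1), ‖shiftSeq τ ε (t : ℤ)‖ ^ 2 :=
      Finset.sum_nonneg fun _ _ => sq_nonneg _
    have := pow_le_pow_left₀ (Real.sqrt_nonneg _) h2 2
    rwa [Real.sq_sqrt h3] at this
  · rw [Finset.card_range, nsmul_eq_mul]
    push_cast; rfl

/-! ### Comparison of logarithms and constants with the remainder term -/

theorem one_add_log_div_eight_le {α : ℝ} (hα0 : 0 < α) (hα1 : α < 1) :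
    0 ≤ Real.log (1 / (α / 8)) ∧
      1 + Real.log (1 / (α / 8)) ≤ 4 * (1 + Real.log (1 / α)) := by
  have hL : 0 ≤ Real.log (1 / α) := Real.log_nonneg ((one_le_div hα0).2 hα1.le)
  have h8 : Real.log 8 ≤ 3 := by
    rw [show (8 : ℝ) = 2 ^ 3 by norm_num, Real.log_pow]
    have := Real.log_two_lt_d9
    push_cast
    linarith
  have h8' : 0 ≤ Real.log 8 := Real.log_nonneg (by norm_num)
  have : Real.log (1 / (α / 8)) = Real.log 8 + Real.log (1 / α) := by
    rw [← Real.log_mul (by norm_num) (by positivity)]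
    congr 1
    field_simp
  rw [this]
  constructor <;> linarith

theorem one_add_log_div_sq_le {m n : ℕ} (hm : 1 ≤ m) (hn : n = 2 * m) {α : ℝ} (hα0 : 0 < α)
    (hα1 : α < 1) :
    0 ≤ Real.log (1 / (α / (16 * ((n : ℝ) + 1) ^ 2))) ∧
      1 + Real.log (1 / (α / (16 * ((n : ℝ) + 1) ^ 2))) ≤ 6 * Real.log (((m : ℝ) + n) / α) := by
  have hL : 0 ≤ Real.log (1 / α) := Real.log_nonneg ((one_le_div hα0).2 hα1.le)
  have hm1 : (1 : ℝ) ≤ m := by exact_mod_cast hm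
  have hn' : (n : ℝ) = 2 * m := by exact_mod_cast hn
  have hN : (0 : ℝ) < (n : ℝ) + 1 := by positivity
  have h16 : Real.log 16 ≤ 3 := by
    rw [show (16 : ℝ) = 2 ^ 4 by norm_num, Real.log_pow]
    have := Real.log_two_lt_d9
    push_cast
    linarith
  have h16' : 0 ≤ Real.log 16 := Real.log_nonneg (by norm_num)
  have e1 : Real.log (1 / (α / (16 * ((n : ℝ) + 1) ^ 2)))
      = Real.log 16 + 2 * Real.log ((n : ℝ) + 1) + Real.log (1 / α) := by
    have : 2 * Real.log ((n : ℝ) + 1) = Real.log (((n : ℝ) + 1) ^ 2) := by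
      rw [Real.log_pow]; norm_num
    rw [this, ← Real.log_mul (by norm_num) (by positivity),
      ← Real.log_mul (by positivity) (by positivity)]
    congr 1
    field_simp
  have e2 : Real.log (((m : ℝ) + n) / α) = Real.log ((m : ℝ) + n) + Real.log (1 / α) := by
    rw [← Real.log_mul (by positivity) (by positivity)]
    congr 1
    field_simp
  -- Here `m ≥ 1` is needed; it also gives `m + n ≥ 3 > e` for the next bound, which lets the
  -- logarithm absorb constants.
  have e3 : Real.log ((n : ℝ) + 1) ≤ Real.log ((m : ℝ) + n) :=
    Real.log_le_log hN (by linarith)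
  have e4 : 1 ≤ Real.log ((m : ℝ) + n) := by
    rw [Real.le_log_iff_exp_le (by positivity)]
    linarith [Real.exp_one_lt_d9]
  have e5 : 0 ≤ Real.log ((n : ℝ) + 1) := Real.log_nonneg (by linarith [Nat.cast_nonneg (α := ℝ) n])
  rw [e1, e2]
  constructor <;> linarith

/-- The cross term `ρ √s` is split into `ρ²` and `s`, so the dimension enters only additively. The
union-bound logarithms go into `ρ Λ`, which the remainder dominates because `(n + 1) / (m + 1) ≥ 1`.
-/
theorem oracle_bound_le {m n s : ℕ} (hm : 1 ≤ m) (hn : n = 2 * m) (hs : 1 ≤ s) {ρ ϰ α : ℝ}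
    (hρ : 1 ≤ ρ) (hϰ : 0 ≤ ϰ) (hα0 : 0 < α) (hα1 : α < 1) {l l' : ℝ} (hl0 : 0 ≤ l)
    (hl : 1 + l ≤ 4 * (1 + Real.log (1 / α)))
    (hl' : 1 + l' ≤ 6 * Real.log (((m : ℝ) + n) / α)) (hl0' : 0 ≤ l') :
    80 * (ρ ^ 2 * (1 + l)) + 24 * (s + l) + 4 * (8 * ρ * ϰ * √(1 + l) + 32 * ρ * (√s + (1 + l')))
      ≤ 1000 * (ρ ^ 2 * (1 + Real.log (1 / α)) + oracleRemainder m n ρ ϰ s α) ∧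
    2 + 8 * ρ ^ 2 + 16 * (ρ * (1 + l')) + 32 * (ρ ^ 2 * (1 + l))
      ≤ 1000 * (ρ ^ 2 * (1 + Real.log (1 / α)) + oracleRemainder m n ρ ϰ s α) := by
  have hL : 0 ≤ Real.log (1 / α) := Real.log_nonneg ((one_le_div hα0).2 hα1.le)
  have hm1 : (1 : ℝ) ≤ m := by exact_mod_cast hm
  have hs1 : (1 : ℝ) ≤ s := by exact_mod_cast hs
  have hn' : (n : ℝ) = 2 * m := by exact_mod_cast hn
  set L := Real.log (1 / α)
  set Λ := Real.log (((m : ℝ) + n) / α)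
  have hκ : 1 ≤ ((n : ℝ) + 1) / ((m : ℝ) + 1) := by
    rw [one_le_div (by positivity)]
    linarith
  have hΛ : 0 ≤ Λ := by linarith
  have hρΛ : ρ * Λ ≤ ρ * (((n : ℝ) + 1) / ((m : ℝ) + 1)) * Λ := by
    rw [mul_assoc]
    refine mul_le_mul_of_nonneg_left ?_ (by linarith)
    nlinarith
  have hρ2 : 1 ≤ ρ ^ 2 := one_le_pow₀ hρ
  have hsq : √(1 + l) ≤ 2 * √(1 + L) := by
    rw [Real.sqrt_le_left (by positivity), mul_pow, Real.sq_sqrt (by positivity)]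
    linarith
  have f1 : ρ ^ 2 * (1 + l) ≤ 4 * (ρ ^ 2 * (1 + L)) := by nlinarith
  have f2 : ρ * ϰ * √(1 + l) ≤ 2 * (ρ * ϰ * √(1 + L)) := by
    have := mul_le_mul_of_nonneg_left hsq (by positivity : 0 ≤ ρ * ϰ)
    linarith
  have f3 : ρ * (1 + l') ≤ 6 * (ρ * Λ) := by nlinarith
  have f4 : ρ * √s ≤ (ρ ^ 2 + s) / 2 := by
    have := Real.sq_sqrt (by positivity : (0 : ℝ) ≤ s)
    nlinarith [sq_nonneg (ρ - √s)]
  have f5 : 1 + L ≤ ρ ^ 2 * (1 + L) := by nlinarith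
  have f6 : ρ ^ 2 ≤ ρ ^ 2 * (1 + L) := by nlinarith
  have f7 : 0 ≤ ρ * ϰ * √(1 + L) := by positivity
  have f8 : 0 ≤ ρ * Λ := by positivity
  have hE : ρ ^ 2 * (1 + L) + (ρ * Λ + ρ * ϰ * √(1 + L) + s)
      ≤ ρ ^ 2 * (1 + L) + oracleRemainder m n ρ ϰ s α := by
    unfold oracleRemainder
    linarith
  constructor <;> linarith

/-! ### Assembly of the proposition -/

theorem mainTheorem11 :
    ∃ C : ℝ, 0 < C ∧
      ∀ (Ω : Type*) [MeasurableSpace Ω] (μ : Measure Ω) [IsProbabilityMeasure μ]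
        (ζ : ℤ → Ω → ℂ) (_hζ : IsStdComplexGaussianNoise μ ζ)
        (σ : ℝ) (_hσ : 0 < σ)
        (m n h₀ s : ℕ) (_hm : 1 ≤ m) (_hn : n = 2 * m)
        (ρ ϰ : ℝ) (_hρ : 1 ≤ ρ) (_hϰ : 0 ≤ ϰ)
        (x : ℤ → ℂ)
        (_hpred : IsPredictableSignal μ ζ σ m (n + 2 * h₀) h₀ ρ x)
        (_hshift : IsNearShiftInvariantOn (-(n : ℤ)) ((n : ℤ) + 2 * h₀) n s ϰ σ x)
        (α : ℝ) (_hα₀ : 0 < α) (_hα₁ : α < 1),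
        ∃ Ξ : Set (ℤ → ℂ), MeasurableSet Ξ ∧
          1 - α ≤ μ.real {ω | (fun t => ζ t ω) ∈ Ξ} ∧
          ∀ z ∈ Ξ, ∀ φ : ℤ → ℂ,
            IsPredictLSE n (2 * h₀) (2 * ρ) (observedSeq x σ z) φ →
              windowNorm n
                  (shiftSeq (-(2 * h₀ : ℤ)) (x - convSeq φ (observedSeq x σ z))) ^ 2
                ≤ C * σ ^ 2 *
                    (ρ ^ 2 * (1 + Real.log (1 / α)) + oracleRemainder m n ρ ϰ s α) ∧
              ∀ t : ℤ, (m : ℤ) + 3 * h₀ ≤ t → t ≤ (n : ℤ) + 3 * h₀ →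
                ‖(x - convSeq φ (observedSeq x σ z)) t‖ ^ 2
                  ≤ C * (σ ^ 2 * ρ / ((n : ℝ) + 1)) *
                      (ρ ^ 2 * (1 + Real.log (1 / α)) + oracleRemainder m n ρ ϰ s α) := by
  -- The window bound needs `1000`; the five-term pointwise bound needs `5 * (1000 + 1000)`.
  refine ⟨10000, by norm_num, ?_⟩
  intro Ω _ μ _ ζ hζ σ hσ m n h₀ s hm hn ρ ϰ hρ hϰ x hpred hshift α hα₀ hα₁
  obtain ⟨q, hq, hb, hq2⟩ := hpred.exists_filter hζ hσ
  have hb' : ∀ t : ℤ, -(m : ℤ) + h₀ ≤ t → t ≤ n + 3 * h₀ →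
      ‖(x - convSeq q x) t‖ ^ 2 ≤ σ ^ 2 * (ρ / (m + 1)) := fun t h1 h2 =>
    hb t h1 (by push_cast; linarith)
  obtain ⟨hs1, -, S, hfin, hrank, hS, xS, hxS, ε, hx, hε⟩ := hshift
  have hdim : (Module.finrank ℂ (S.map (window n (2 * h₀))) : ℝ) ≤ s := by
    exact_mod_cast hrank ▸ Submodule.finrank_map_le (window n (2 * h₀)) S
  have hε' := sum_norm_sq_window_harmonicFilter_le (n := n) (ε := ε) (η := ϰ * σ)
    fun τ h1 h2 => hε τ (by linarith) (by linarith)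
  obtain ⟨Ξ, hΞ, hgood⟩ := hζ.exists_isNoiseEvent_isGoodNoise hn (η := ϰ * σ) (s := s) hρ
    (by exact_mod_cast hs1) _ hdim hq hq2 hε' hα₀
  obtain ⟨hl, hl4⟩ := one_add_log_div_eight_le hα₀ hα₁
  obtain ⟨hl', hl6⟩ := one_add_log_div_sq_le hm hn hα₀ hα₁
  obtain ⟨hT1, hT2⟩ := oracle_bound_le hm hn hs1 hρ hϰ hα₀ hα₁ hl hl4 hl6 hl'
  refine ⟨Ξ, hΞ.1, hΞ.2, fun z hz φ hφ => ?_⟩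
  have hz := hgood z hz
  set T := ρ ^ 2 * (1 + Real.log (1 / α)) + oracleRemainder m n ρ ϰ s α
  have hT : 0 ≤ T := by
    have : 0 ≤ 2 + 8 * ρ ^ 2 + 16 * (ρ * (1 + Real.log (1 / (α / (16 * ((n : ℝ) + 1) ^ 2)))))
        + 32 * (ρ ^ 2 * (1 + Real.log (1 / (α / 8)))) := by positivity
    linarith
  have hσ2 : 0 ≤ σ ^ 2 := sq_nonneg σ
  have hw : ‖window n (2 * h₀) (x - convSeq φ (observedSeq x σ z))‖ ^ 2
      ≤ 1000 * σ ^ 2 * T := by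
    have h1 := norm_sq_window_error_le hn hρ hl hl' hσ hϰ hq hq2 hb' hS hxS hx hz hφ
    have h2 := mul_le_mul_of_nonneg_left hT1 hσ2
    linarith
  refine ⟨?_, fun t ht1 ht2 => ?_⟩
  · rw [windowNorm_shiftSeq]
    refine hw.trans ?_
    gcongr
    norm_num
  · have hφs := hφ.1.1
    have hφ1 := hφ.1.2
    push_cast at hφs hφ1
    refine (norm_sq_error_apply_le hn hρ hl hl' hq hq2 hb' hz hφs hφ1 hw ht1 ht2).trans ?_
    have h2 := mul_le_mul_of_nonneg_left hT2 hσ2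
    have hc : 0 ≤ ρ / ((n : ℝ) + 1) := by positivity
    calc _ ≤ 5 * (ρ / ((n : ℝ) + 1) * (2000 * σ ^ 2 * T)) := by
          gcongr
          linarith
      _ = 10000 * (σ ^ 2 * ρ / ((n : ℝ) + 1)) * T := by ring
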